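/- **Setting.** Let $\Omega\subset\mathbb R^2$ be compact and let $w(x,y,t)$, $(x,y)\in\Omega$, $t\ge 0$, be a time-dependent normalized weight: for every $t\ge0$ the function $w(\cdot,\cdot,t)$ is nonnegative and Lebesgue integrable on $\Omega$, $\int_\Omega w(x,y,t)\,dx\,dy=1$, and $\int_\Omega p(x,y)^2\,w(x,y,t)\,dx\,dy>0$ for every real polynomial $p\ne0$; moreover $t\mapsto w(x,y,t)$ is continuous on $[0,\infty)$ for each $(x,y)\in\Omega$. Put $w(x,y)=w(x,y,0)$ and $\langle p,q\rangle_t=\int_\Omega p\,q\,w(x,y,t)\,dx\,dy$ (entrywise for polynomial matrices: $\langle \mathsf A,\mathsf B\rangle_t=\int_\Omega \mathsf A\mathsf B\,w\,dx\,dy$). Let $\omega_{h,k}(t)=\int_\Omega x^hy^k\,w(x,y,t)\,dx\,dy$ and $\mathbb X_n=(x^n,x^{n-1}y,\dots,y^n)^\top$. Let $\{\mathbb P_n(t)\}_{n\ge0}$ be the monic orthogonal polynomial system of $w(\cdot,\cdot,t)$: $\mathbb P_n(t)$ is a vector of $n+1$ polynomials, $\mathbb P_n(t)=\mathbb X_n+(\text{terms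 of degree}<n)$, $\langle\mathbb P_n,\mathbb P_m^\top\rangle_t=0$ for $n\ne m$, and $H_n(t)=\langle\mathbb P_n,\mathbb P_n^\top\rangle_t$ is symmetric positive definite. Let $x_1=x$, $x_2=y$, and let $L_{n,i}$ be the $(n+1)\times(n+2)$ matrices with $L_{n,i}\mathbb X_{n+1}=x_i\mathbb X_n$. The block coefficients of the three term relations $x_i\mathbb P_n=L_{n,i}\mathbb P_{n+1}+D_{n,i}\mathbb P_n+C_{n,i}\mathbb P_{n-1}$ are given by $D_{n,i}H_n=\langle x_i\mathbb P_n,\mathbb P_n^\top\rangle_t$ ($n\ge0$) and $C_{n,i}H_{n-1}=H_nL_{n-1,i}^\top$ ($n\ge1$). Put $D_n=D_{n,1}+D_{n,2}$ and $C_n=C_{n,1}+C_{n,2}$. The $1\times1$ matrix $D_0$ is read as a number. Let $J_i(t)$ be the infinite block tridiagonal matrix with diagonal blocks $D_{n,i}$ at $(n,n)$, blocks $C_{n+1,i}$ at $(n+1,n)$ and $L_{n,i}$ at $(n,n+1)$, $n\ge0$, and let $A(t)$ be the infinite block matrix with blocks $C_{n+1}$ at $(n+1,n)$, $n\ge 0$,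 and zeros elsewhere; $[A,M]=AM-MA$. Finally put $$S(z_1,z_2,t)=\int_\Omega\frac{w(x,y,t)}{(z_1-x)(z_2-y)}\,dx\,dy,\qquad S_{1,0}(z,t)=\sum_{h\ge0}\frac{\omega_{h,0}(t)}{z^{h+1}},\qquad S_{2,0}(z,t)=\sum_{k\ge0}\frac{\omega_{0,k}(t)}{z^{k+1}} .$$ A dot is the derivative in $t$ on $[0,\infty)$ (one-sided at $t=0$), taken entrywise for matrices and coefficientwise for polynomials; an equation with a dot includes the assertion that the derivative exists. **Theorem.** The following eight statements are equivalent: (i) for all $n\ge1$, $i=1,2$ and $t\ge0$: $\dot D_{n,i}=C_nL_{n-1,i}-L_{n,i}C_{n+1}$ and $\dot C_{n,i}=C_nD_{n-1,i}-D_{n,i}C_n$; (ii) $\dot J_i=[A,J_i]$ for $i=1,2$ and all $t\ge0$; (iii) $\frac{d}{dt}\big(J_1^hJ_2^k\big)=[A,J_1^hJ_2^k]$ for all $h,k\ge0$ and $t\ge0$; (iv) $\dot\omega_{h,k}=-\omega_{h+1,k}-\omega_{h,k+1}+\omega_{h,k}(\omega_{1,0}+\omega_{0,1})$ for all $h,k\ge0$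 and $t\ge0$; (v) $\dot S(z_1,z_2,t)=(D_0(t)-z_1-z_2)\,S(z_1,z_2,t)+S_{1,0}(z_1,t)+S_{2,0}(z_2,t)$ for all $t\ge0$ and all $z_1,z_2\in\mathbb C$ with $|z_1|>|x|$ and $|z_2|>|y|$ for every $(x,y)\in\Omega$; (vi) for almost every $(x,y)\in\Omega$: $\dot w(x,y,t)=-(x+y-D_0(t))\,w(x,y,t)$ for all $t\ge0$; (vii) for almost every $(x,y)\in\Omega$: $\displaystyle w(x,y,t)=\frac{e^{-(x+y)t}\,w(x,y)}{\int_\Omega e^{-(x'+y')t}\,w(x',y')\,dx'\,dy'}$ for all $t\ge0$; (viii) $\dot{\mathbb P}_n(t)=C_n(t)\,\mathbb P_{n-1}(t)$ for all $n\ge1$ and $t\ge0$. -/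

import Mathlib

open MeasureTheory Set

namespace Toda2D

noncomputable section

/-- A (time-dependent) normalized weight `w t (x, y)` on `Ω ⊆ ℝ²`, for times `t ≥ 0`. Points are
functions `z : Fin 2 → ℝ` with `x = z 0`, `y = z 1`, and integrals are taken against Lebesgue
measure. On a compact `Ω` integrability of `w t` gives the finiteness of all moments. -/
structure IsTimeWeight (Ω : Set (Fin 2 → ℝ)) (w : ℝ → (Fin 2 → ℝ) → ℝ) : Prop where
  nonneg : ∀ t, 0 ≤ t → ∀ z ∈ Ω, 0 ≤ w t z
  integrable : ∀ t, 0 ≤ t → IntegrableOn (w t) Ω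
  normalized : ∀ t, 0 ≤ t → ∫ z in Ω, w t z = 1
  posDef : ∀ t, 0 ≤ t → ∀ p : MvPolynomial (Fin 2) ℝ, p ≠ 0 →
    0 < ∫ z in Ω, (MvPolynomial.eval z p) ^ 2 * w t z
  /-- the weight evolves continuously in time -/
  continuous_time : ∀ z ∈ Ω, ContinuousOn (fun t => w t z) (Ici 0)

/-- The moments `ω_{h,k} = ∫_Ω x^h y^k u(x,y) dx dy`. -/
def moment (Ω : Set (Fin 2 → ℝ)) (u : (Fin 2 → ℝ) → ℝ) (h k : ℕ) : ℝ :=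
  ∫ z in Ω, z 0 ^ h * z 1 ^ k * u z

/-- The inner product `⟨p, q⟩ = ∫_Ω p q u dx dy`. -/
def polyInner (Ω : Set (Fin 2 → ℝ)) (u : (Fin 2 → ℝ) → ℝ) (p q : MvPolynomial (Fin 2) ℝ) : ℝ :=
  ∫ z in Ω, MvPolynomial.eval z p * MvPolynomial.eval z q * u z

/-- A sequence of polynomial vectors `ℙ_n` of size `n + 1`. -/
abbrev PolySeq : Type := (n : ℕ) → Fin (n + 1) → MvPolynomial (Fin 2) ℝ

/-- `H_n = ⟨ℙ_n, ℙ_nᵀ⟩`. -/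
def gram (Ω : Set (Fin 2 → ℝ)) (u : (Fin 2 → ℝ) → ℝ) (P : PolySeq) (n : ℕ) :
    Matrix (Fin (n + 1)) (Fin (n + 1)) ℝ :=
  Matrix.of fun a b => polyInner Ω u (P n a) (P n b)

/-- `ℙ` is the monic orthogonal polynomial system of the weight `u` on `Ω`: the `m`-th entry of
`ℙ_n` is `x^(n-m) y^m` plus terms of total degree less than `n`, `ℙ_n ⟂ ℙ_m` for `n ≠ m`, and
`H_n` is symmetric and positive definite. -/
structure IsMonicOPS (Ω : Set (Fin 2 → ℝ)) (u : (Fin 2 → ℝ) → ℝ) (P : PolySeq) : Prop where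
  monic : ∀ (n : ℕ) (m : Fin (n + 1)),
    ∀ s ∈ (P n m - MvPolynomial.X 0 ^ (n - (m : ℕ)) * MvPolynomial.X 1 ^ (m : ℕ)).support,
      s.degree < n
  orthogonal : ∀ n m : ℕ, n ≠ m → ∀ (a : Fin (n + 1)) (b : Fin (m + 1)),
    polyInner Ω u (P n a) (P m b) = 0
  gram_posDef : ∀ n, (gram Ω u P n).PosDef

/-- The shift matrices: `L_{n,1} 𝕏_{n+1} = x 𝕏_n` (`i = 0`) and `L_{n,2} 𝕏_{n+1} = y 𝕏_n`
(`i = 1`). -/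
def shiftL (i : Fin 2) (n : ℕ) : Matrix (Fin (n + 1)) (Fin (n + 2)) ℝ :=
  Matrix.of fun a b => if (b : ℕ) = (a : ℕ) + (i : ℕ) then 1 else 0

/-- The coefficient `D_{n,i}` of the three term relation
`x_i ℙ_n = L_{n,i} ℙ_{n+1} + D_{n,i} ℙ_n + C_{n,i} ℙ_{n-1}`: `D_{n,i} H_n = ⟨x_i ℙ_n, ℙ_nᵀ⟩`.
The variable `x` has index `0` and `y` has index `1`. -/
def coefD (Ω : Set (Fin 2 → ℝ)) (u : (Fin 2 → ℝ) → ℝ) (P : PolySeq) (i : Fin 2) (n : ℕ) :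
    Matrix (Fin (n + 1)) (Fin (n + 1)) ℝ :=
  (Matrix.of fun a b => polyInner Ω u (MvPolynomial.X i * P n a) (P n b)) * (gram Ω u P n)⁻¹

/-- The coefficient `C_{n+1,i}` (note the shift of the index) of the three term relation, of size
`(n + 2) × (n + 1)`: `C_{n+1,i} H_n = H_{n+1} L_{n,i}ᵀ`. -/
def coefC (Ω : Set (Fin 2 → ℝ)) (u : (Fin 2 → ℝ) → ℝ) (P : PolySeq) (i : Fin 2) (n : ℕ) :
    Matrix (Fin (n + 2)) (Fin (n + 1)) ℝ :=
  gram Ω u P (n + 1) * (shiftL i n).transpose * (gram Ω u P n)⁻¹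

/-- `D_n = D_{n,1} + D_{n,2}`. -/
def sumD (Ω : Set (Fin 2 → ℝ)) (u : (Fin 2 → ℝ) → ℝ) (P : PolySeq) (n : ℕ) :
    Matrix (Fin (n + 1)) (Fin (n + 1)) ℝ :=
  coefD Ω u P 0 n + coefD Ω u P 1 n

/-- `C_{n+1} = C_{n+1,1} + C_{n+1,2}` (index shifted as in `coefC`). -/
def sumC (Ω : Set (Fin 2 → ℝ)) (u : (Fin 2 → ℝ) → ℝ) (P : PolySeq) (n : ℕ) :
    Matrix (Fin (n + 2)) (Fin (n + 1)) ℝ :=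
  coefC Ω u P 0 n + coefC Ω u P 1 n

/-- Indices of infinite block matrices: the position `⟨n, a⟩` is row (or column) `a` of the `n`-th
block, which has size `n + 1`. -/
abbrev BlockIdx : Type := (n : ℕ) × Fin (n + 1)

/-- Infinite block matrices, with a block of size `(n + 1) × (m + 1)` at `(n, m)`. -/
abbrev BlockMat : Type := Matrix BlockIdx BlockIdx ℝ

/-- The block Jacobi matrix `J_i`, with blocks `D_{n,i}` at `(n, n)`, `C_{n+1,i}` at `(n + 1, n)`,
`L_{n,i}` at `(n, n + 1)`, and zero elsewhere. -/
def jacobi (Ω : Set (Fin 2 → ℝ)) (u : (Fin 2 → ℝ) → ℝ) (P : PolySeq) (i : Fin 2) : BlockMat :=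
  Matrix.of fun r c =>
    if h : c.1 = r.1 then coefD Ω u P i r.1 r.2 (Fin.cast (congrArg (· + 1) h) c.2)
    else if h : r.1 = c.1 + 1 then coefC Ω u P i c.1 (Fin.cast (congrArg (· + 1) h) r.2) c.2
    else if h : c.1 = r.1 + 1 then shiftL i r.1 r.2 (Fin.cast (congrArg (· + 1) h) c.2)
    else 0

/-- The block matrix `A`, with blocks `C_{n+1}` at `(n + 1, n)` and zero elsewhere. -/
def matA (Ω : Set (Fin 2 → ℝ)) (u : (Fin 2 → ℝ) → ℝ) (P : PolySeq) : BlockMat :=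
  Matrix.of fun r c =>
    if h : r.1 = c.1 + 1 then sumC Ω u P c.1 (Fin.cast (congrArg (· + 1) h) r.2) c.2 else 0

/-- The product of infinite block matrices. It is used only for matrices whose rows have finitely
many nonzero entries, where each entry of the product is a finite sum. -/
def infMul (M N : BlockMat) : BlockMat :=
  Matrix.of fun r c => ∑ᶠ s : BlockIdx, M r s * N s c

/-- Powers of an infinite block matrix. -/
def infPow (M : BlockMat) : ℕ → BlockMat
  | 0 => 1
  | n + 1 => infMul (infPow M n) M

/-- The commutator `[M, N] = M N - N M`. -/
def infComm (M N : BlockMat) : BlockMat := infMul M N - infMul N M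

/-- `M' = dM/dt` at the time `t ≥ 0`, entry by entry (one-sided derivative at `t = 0`). -/
def HasEntryDeriv {α β : Type} (M : ℝ → Matrix α β ℝ) (M' : Matrix α β ℝ) (t : ℝ) : Prop :=
  ∀ a b, HasDerivWithinAt (fun s => M s a b) (M' a b) (Ici 0) t

/-- The Stieltjes function `S(z₁, z₂) = ∫_Ω u(x,y) / ((z₁ - x)(z₂ - y)) dx dy`. -/
def stieltjes (Ω : Set (Fin 2 → ℝ)) (u : (Fin 2 → ℝ) → ℝ) (z₁ z₂ : ℂ) : ℂ :=
  ∫ z in Ω, (u z : ℂ) / ((z₁ - (z 0 : ℂ)) * (z₂ - (z 1 : ℂ)))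

/-- The first `k`-marginal series `S_{1,k}(z) = ∑_h ω_{h,k} / z^(h+1)`. -/
def marginal₁ (Ω : Set (Fin 2 → ℝ)) (u : (Fin 2 → ℝ) → ℝ) (k : ℕ) (ζ : ℂ) : ℂ :=
  ∑' h : ℕ, (moment Ω u h k : ℂ) / ζ ^ (h + 1)

/-- The second `h`-marginal series `S_{2,h}(z) = ∑_k ω_{h,k} / z^(k+1)`. -/
def marginal₂ (Ω : Set (Fin 2 → ℝ)) (u : (Fin 2 → ℝ) → ℝ) (h : ℕ) (ζ : ℂ) : ℂ :=
  ∑' k : ℕ, (moment Ω u h k : ℂ) / ζ ^ (k + 1)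

end

end Toda2D

open Toda2D

/-!
Write `Λ_t(p) = ∫ p w(·,·,t)` for polynomials `p`, `D = D_0 = Λ_t(x + y)`, and `𝓕` for the
equation `d/dt ∫ f w = ∫ (D - x - y) f w` tested against a function `f` (`WeightFlow`; for
polynomials in terms of `Λ` it is `MomentFlow`). All eight statements are forms of this linear
equation.

*Analysis.* The moment equations are `𝓕` for monomials, and the equation of the Stieltjes function
is `𝓕` for the kernels `1 / ((z₁ - x)(z₂ - y))`, by the Laurent expansion of the marginal functions
(`IsTimeWeight.stieltjes_rhs`). The solutions `f` of `𝓕` form a linear space which is closed under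
uniform limits, because the time derivative is bounded by a multiple of `sup |f|`
(`WeightFlow.of_approx`). As `z₁, z₂ → ∞` along the reals the kernels yield all monomials
(`WeightFlow.pow_mul`). Conversely, if `𝓕` holds for all polynomials and `c` is the integrating
factor `exp (-∫ D)`, then `c(t) Λ_t((x + y)^n p)` and `∫ e^(-(x+y)t) (x + y)^n p w(·,·,0)` satisfy
the same chain `ȧ_n = -a_(n+1)` with the same initial values and geometric bounds in `n`, hence
agree (`eq_zero_of_deriv_chain`). A weight on a compact set is determined by its moments
(`ae_eq_zero_of_moments`), so the weight has the explicit form for almost every point at each time,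
and, by continuity in time, for almost every point at all times. The explicit form gives `𝓕` for
every continuous `f` by differentiation under the integral sign, and it is equivalent to the
differential equation for `w`, since the functions `e^((x+y)t) w` all solve `ġ = D g`.

*Algebra.* The block `C_n ℙ_(n-1)` is the projection of `(x + y) ℙ_n` to the polynomials of degree
`< n` (`inner_sumC`). Differentiating the orthogonality relations `Λ_t(ℙ_n p) = 0` turns the moment
equations into `ℙ̇_n = C_n ℙ_(n-1)`, that is `ℙ̇ = A ℙ` for the infinite vector `ℙ`
(`polyFlow_of_momentFlow`). Differentiating `J_i ℙ = x_i ℙ` then gives `(J̇_i - [A, J_i]) ℙ = 0`,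
hence the Lax equations by linear independence of the entries of `ℙ` (`laxFlow_of_polyFlow`); they
pass to products since `[A, ·]` is a derivation. The `(0, 0)` entry of `J_1^h J_2^k` is the moment
`ω_(h,k)`, so that the Lax equations for the products contain the moment equations
(`infComm_jacobiMonomial_zero_zero`). Finally, the lattice equations are the nontrivial blocks of
the Lax equations, except that `D_0` is missing from them; its evolution is recovered from that of
`D_(1,1)` and `D_(1,2)` by the commutation of multiplication by `x` and `y`
(`coefD_one_compat`, `laxFlow_of_lattice`).
-/

open MvPolynomial

namespace Toda2D

noncomputable section

/-! ### Polynomials of bounded degree -/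

/-- Real polynomials in two variables. -/
abbrev Poly₂ : Type := MvPolynomial (Fin 2) ℝ

/-- The space of polynomials of total degree `< n`; in particular `degLT 0 = ⊥`. -/
def degLT (n : ℕ) : Submodule ℝ Poly₂ := restrictSupport ℝ {s | s.degree < n}

lemma mem_degLT_iff_support {n : ℕ} {p : Poly₂} : p ∈ degLT n ↔ ∀ s ∈ p.support, s.degree < n :=
  Iff.rfl

lemma mem_degLT {n : ℕ} {p : Poly₂} : p ∈ degLT n ↔ ∀ s, n ≤ s.degree → coeff s p = 0 := by
  rw [mem_degLT_iff_support]
  refine forall_congr' fun s => ?_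
  rw [mem_support_iff]
  constructor
  · intro h hs
    by_contra hc
    exact absurd (h hc) (not_lt.2 hs)
  · intro h hc
    by_contra hs
    exact hc (h (not_lt.1 hs))

lemma degLT_mono {m n : ℕ} (h : m ≤ n) : degLT m ≤ degLT n := fun _ hp =>
  mem_degLT.2 fun s hs => mem_degLT.1 hp s (h.trans hs)

lemma eq_zero_of_mem_degLT_zero {p : Poly₂} (hp : p ∈ degLT 0) : p = 0 := by
  ext s
  simpa using mem_degLT.1 hp s (Nat.zero_le _)

lemma mul_mem_degLT {m n : ℕ} {p q : Poly₂} (hp : p ∈ degLT (m + 1)) (hq : q ∈ degLT n) :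
    p * q ∈ degLT (m + n) := by
  rw [mem_degLT]
  intro s hs
  rw [coeff_mul]
  refine Finset.sum_eq_zero fun x hx => ?_
  rw [Finset.HasAntidiagonal.mem_antidiagonal] at hx
  rw [← hx, map_add] at hs
  by_cases h : m + 1 ≤ x.1.degree
  · rw [mem_degLT.1 hp _ h, zero_mul]
  · rw [mem_degLT.1 hq _ (by omega), mul_zero]

lemma C_mem_degLT (c : ℝ) : (C c : Poly₂) ∈ degLT 1 := by
  rw [mem_degLT]
  intro s hs
  rw [coeff_C, if_neg]
  rintro rfl
  simp at hs

lemma X_mem_degLT (i : Fin 2) : (X i : Poly₂) ∈ degLT 2 := by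
  rw [mem_degLT]
  intro s hs
  rw [coeff_X, if_neg]
  rintro rfl
  simp at hs

lemma X_mul_mem_degLT (i : Fin 2) {n : ℕ} {p : Poly₂} (hp : p ∈ degLT n) :
    X i * p ∈ degLT (n + 1) := by
  rw [add_comm]
  exact mul_mem_degLT (X_mem_degLT i) hp

lemma X_pow_mul_X_pow (h k : ℕ) :
    (X 0 ^ h * X 1 ^ k : Poly₂) = monomial (Finsupp.single 0 h + Finsupp.single 1 k) 1 := by
  rw [X_pow_eq_monomial, X_pow_eq_monomial, monomial_mul, one_mul]

lemma monomial_eq_X_pow (e : Fin 2 →₀ ℕ) : (monomial e 1 : Poly₂) = X 0 ^ e 0 * X 1 ^ e 1 := by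
  rw [X_pow_mul_X_pow]
  congr 2
  ext i
  fin_cases i <;> simp

lemma degree_eq (e : Fin 2 →₀ ℕ) : e.degree = e 0 + e 1 := by
  rw [Finsupp.degree_eq_sum, Fin.sum_univ_two]

lemma X_pow_mul_X_pow_mem (h k : ℕ) : (X 0 ^ h * X 1 ^ k : Poly₂) ∈ degLT (h + k + 1) := by
  rw [X_pow_mul_X_pow]
  refine (monomial_mem_restrictSupport ℝ).2 (Or.inl ?_)
  simp [degree_eq]

lemma degLT_eq_span (n : ℕ) :
    degLT n = Submodule.span ℝ ((fun e => (monomial e 1 : Poly₂)) '' {s | s.degree < n}) :=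
  restrictSupport_eq_span _ _

/-! ### Orthogonal systems at a fixed time -/

/-- `Λ` is the integration functional `p ↦ ∫ p u` of a normalized weight `u` on `Ω` that is
positive on squares. -/
structure IsIntegral (Ω : Set (Fin 2 → ℝ)) (u : (Fin 2 → ℝ) → ℝ) (Λ : Poly₂ →ₗ[ℝ] ℝ) :
    Prop where
  apply_eq : ∀ p, Λ p = ∫ z in Ω, eval z p * u z
  one : Λ 1 = 1
  pos : ∀ p, p ≠ 0 → 0 < Λ (p ^ 2)

/-- The entries of all the vectors of a polynomial system, as one family. -/
def entries (P : PolySeq) (s : BlockIdx) : Poly₂ := P s.1 s.2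

variable {Ω : Set (Fin 2 → ℝ)} {u : (Fin 2 → ℝ) → ℝ} {P : PolySeq} {Λ : Poly₂ →ₗ[ℝ] ℝ}

lemma IsIntegral.inner (hΛ : IsIntegral Ω u Λ) (p q : Poly₂) :
    polyInner Ω u p q = Λ (p * q) := by
  simp [polyInner, hΛ.apply_eq]

lemma IsIntegral.moment (hΛ : IsIntegral Ω u Λ) (h k : ℕ) :
    moment Ω u h k = Λ (X 0 ^ h * X 1 ^ k) := by
  simp [Toda2D.moment, hΛ.apply_eq]

lemma IsIntegral.eq_zero (hΛ : IsIntegral Ω u Λ) {p : Poly₂} (h : Λ (p * p) = 0) : p = 0 := by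
  by_contra hp
  have := hΛ.pos p hp
  rw [sq, h] at this
  exact lt_irrefl _ this

lemma IsMonicOPS.sub_mem (hP : IsMonicOPS Ω u P) (n : ℕ) (a : Fin (n + 1)) :
    P n a - X 0 ^ (n - (a : ℕ)) * X 1 ^ (a : ℕ) ∈ degLT n :=
  mem_degLT_iff_support.2 (hP.monic n a)

lemma IsMonicOPS.mem (hP : IsMonicOPS Ω u P) (n : ℕ) (a : Fin (n + 1)) :
    P n a ∈ degLT (n + 1) := by
  have h := X_pow_mul_X_pow_mem (n - (a : ℕ)) (a : ℕ)
  rw [Nat.sub_add_cancel (Nat.le_of_lt_succ a.2)] at h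
  have := (degLT (n + 1)).add_mem (degLT_mono (Nat.le_succ n) (hP.sub_mem n a)) h
  rwa [sub_add_cancel] at this

lemma IsMonicOPS.zero (hP : IsMonicOPS Ω u P) (a : Fin 1) : P 0 a = 1 := by
  have h := eq_zero_of_mem_degLT_zero (hP.sub_mem 0 a)
  have ha : (a : ℕ) = 0 := by omega
  rw [ha] at h
  simpa [sub_eq_zero] using h

/-- A monic system spans: `ℙ_0, …, ℙ_(n-1)` span the polynomials of degree `< n`. -/
lemma IsMonicOPS.degLT_le_span (hP : IsMonicOPS Ω u P) (n : ℕ) :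
    degLT n ≤ Submodule.span ℝ (entries P '' {s | s.1 < n}) := by
  induction n with
  | zero =>
    intro p hp
    rw [eq_zero_of_mem_degLT_zero hp]
    exact Submodule.zero_mem _
  | succ n ih =>
    have hmono : Submodule.span ℝ (entries P '' {s | s.1 < n}) ≤
        Submodule.span ℝ (entries P '' {s | s.1 < n + 1}) :=
      Submodule.span_mono (image_mono fun s hs => Nat.lt_succ_of_lt hs)
    rw [degLT_eq_span, Submodule.span_le]
    rintro _ ⟨e, he, rfl⟩
    simp only [mem_ofPred_eq] at he
    rcases Nat.lt_succ_iff_lt_or_eq.1 he with h | h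
    · refine hmono (ih ?_)
      rw [degLT_eq_span]
      exact Submodule.subset_span ⟨e, h, rfl⟩
    · rw [degree_eq] at h
      have h1 := hmono (ih (hP.sub_mem n ⟨e 1, by omega⟩))
      have h2 : P n ⟨e 1, by omega⟩ ∈ Submodule.span ℝ (entries P '' {s | s.1 < n + 1}) :=
        Submodule.subset_span ⟨⟨n, ⟨e 1, by omega⟩⟩, Nat.lt_succ_self n, rfl⟩
      have h3 := Submodule.sub_mem _ h2 h1
      rw [sub_sub_cancel] at h3
      have h4 : n - e 1 = e 0 := by omega
      simp only [h4] at h3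
      simpa only [SetLike.mem_coe, monomial_eq_X_pow] using h3

/-- A vanishing condition that is linear in `p` holds for all `p` of degree `< n` as soon as it
holds for the entries of `ℙ_0, …, ℙ_(n-1)`. -/
lemma IsMonicOPS.map_eq_zero (hP : IsMonicOPS Ω u P) {n : ℕ} (φ : Poly₂ →ₗ[ℝ] ℝ)
    (h : ∀ k < n, ∀ b, φ (P k b) = 0) {p : Poly₂} (hp : p ∈ degLT n) : φ p = 0 := by
  have h1 : Submodule.span ℝ (entries P '' {s | s.1 < n}) ≤ LinearMap.ker φ := by
    rw [Submodule.span_le]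
    rintro _ ⟨s, hs, rfl⟩
    exact h s.1 hs s.2
  exact h1 (hP.degLT_le_span n hp)

lemma IsMonicOPS.orth (hP : IsMonicOPS Ω u P) (hΛ : IsIntegral Ω u Λ) {n : ℕ} (a : Fin (n + 1))
    {p : Poly₂} (hp : p ∈ degLT n) : Λ (P n a * p) = 0 := by
  refine hP.map_eq_zero (Λ ∘ₗ LinearMap.mulLeft ℝ (P n a)) (fun k hk b => ?_) hp
  have := hP.orthogonal n k (by omega) a b
  rwa [hΛ.inner] at this

lemma IsMonicOPS.gram_apply (hΛ : IsIntegral Ω u Λ) (n : ℕ) (a b : Fin (n + 1)) :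
    gram Ω u P n a b = Λ (P n a * P n b) := by
  simp [gram, hΛ.inner]

lemma IsMonicOPS.isUnit_det (hP : IsMonicOPS Ω u P) (n : ℕ) : IsUnit (gram Ω u P n).det :=
  (Matrix.isUnit_iff_isUnit_det _).1 (hP.gram_posDef n).isUnit

/-- A polynomial of degree `< n` that is orthogonal to `ℙ_0, …, ℙ_(n-1)` vanishes. -/
lemma IsMonicOPS.eq_zero_of_orth (hP : IsMonicOPS Ω u P) (hΛ : IsIntegral Ω u Λ) {n : ℕ}
    {p : Poly₂} (hp : p ∈ degLT n) (h : ∀ k < n, ∀ b, Λ (p * P k b) = 0) : p = 0 :=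
  hΛ.eq_zero (hP.map_eq_zero (Λ ∘ₗ LinearMap.mulLeft ℝ p) h hp)

/-- The index of the monomial `x_i x^(n-a) y^a` among the monomials of degree `n + 1`. -/
def shiftIdx (i : Fin 2) {n : ℕ} (a : Fin (n + 1)) : Fin (n + 2) := ⟨a + i, by omega⟩

lemma sum_shiftL {M : Type*} [AddCommMonoid M] [Module ℝ M] (i : Fin 2) (n : ℕ)
    (a : Fin (n + 1)) (v : Fin (n + 2) → M) :
    ∑ b, shiftL i n a b • v b = v (shiftIdx i a) := by
  rw [Finset.sum_eq_single (shiftIdx i a)]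
  · simp [shiftL, shiftIdx]
  · intro b _ hb
    have : (b : ℕ) ≠ a + i := fun h => hb (Fin.ext h)
    simp [shiftL, this]
  · simp

lemma mul_transpose_shiftL {ι : Type*} [Fintype ι] (i : Fin 2) (n : ℕ)
    (M : Matrix ι (Fin (n + 2)) ℝ) (j : ι) (a : Fin (n + 1)) :
    (M * (shiftL i n).transpose) j a = M j (shiftIdx i a) := by
  rw [Matrix.mul_apply, ← sum_shiftL i n a (M j)]
  simp [mul_comm]

lemma shiftL_mul {ι : Type*} (i : Fin 2) (n : ℕ)
    (M : Matrix (Fin (n + 2)) ι ℝ) (a : Fin (n + 1)) (j : ι) :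
    (shiftL i n * M) a j = M (shiftIdx i a) j := by
  rw [Matrix.mul_apply, ← sum_shiftL i n a (fun b => M b j)]
  simp

/-- Multiplication by `x_i` moves `ℙ_n` to the corresponding entries of `ℙ_(n+1)`, up to lower
degree. -/
lemma IsMonicOPS.X_mul_sub_mem (hP : IsMonicOPS Ω u P) (i : Fin 2) (n : ℕ) (a : Fin (n + 1)) :
    X i * P n a - P (n + 1) (shiftIdx i a) ∈ degLT (n + 1) := by
  have h1 := X_mul_mem_degLT i (hP.sub_mem n a)
  have h2 := hP.sub_mem (n + 1) (shiftIdx i a)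
  have h3 : (X 0 ^ (n + 1 - (shiftIdx i a : ℕ)) * X 1 ^ (shiftIdx i a : ℕ) : Poly₂) =
      X i * (X 0 ^ (n - (a : ℕ)) * X 1 ^ (a : ℕ)) := by
    have ha : (a : ℕ) ≤ n := by omega
    fin_cases i
    · simp only [shiftIdx, Fin.zero_eta, Fin.isValue, add_zero]
      rw [Nat.succ_sub ha, pow_succ]
      ring
    · simp only [shiftIdx, Fin.mk_one, Fin.isValue, Nat.add_sub_add_right]
      ring
  rw [h3] at h2
  have h4 := Submodule.sub_mem _ h1 h2
  have h5 : X i * (P n a - X 0 ^ (n - (a : ℕ)) * X 1 ^ (a : ℕ)) -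
      (P (n + 1) (shiftIdx i a) - X i * (X 0 ^ (n - (a : ℕ)) * X 1 ^ (a : ℕ))) =
      X i * P n a - P (n + 1) (shiftIdx i a) := by ring
  rwa [h5] at h4

lemma coefD_mul_gram (hP : IsMonicOPS Ω u P) (hΛ : IsIntegral Ω u Λ) (i : Fin 2) (n : ℕ)
    (a b : Fin (n + 1)) :
    ∑ c, coefD Ω u P i n a c * Λ (P n c * P n b) = Λ (X i * P n a * P n b) := by
  have h : coefD Ω u P i n * gram Ω u P n =
      Matrix.of fun a b => polyInner Ω u (X i * P n a) (P n b) := by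
    rw [coefD, Matrix.mul_assoc, Matrix.nonsing_inv_mul _ (hP.isUnit_det n), Matrix.mul_one]
  have h2 := congrFun (congrFun h a) b
  rw [Matrix.mul_apply] at h2
  simpa only [IsMonicOPS.gram_apply hΛ, hΛ.inner, Matrix.of_apply] using h2

lemma coefC_mul_gram (hP : IsMonicOPS Ω u P) (hΛ : IsIntegral Ω u Λ) (i : Fin 2) (n : ℕ)
    (a : Fin (n + 2)) (b : Fin (n + 1)) :
    ∑ c, coefC Ω u P i n a c * Λ (P n c * P n b) = Λ (P (n + 1) a * (X i * P n b)) := by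
  have h : coefC Ω u P i n * gram Ω u P n =
      gram Ω u P (n + 1) * (shiftL i n).transpose := by
    rw [coefC, Matrix.mul_assoc, Matrix.nonsing_inv_mul _ (hP.isUnit_det n), Matrix.mul_one]
  have h2 := congrFun (congrFun h a) b
  rw [Matrix.mul_apply, mul_transpose_shiftL] at h2
  simp only [IsMonicOPS.gram_apply hΛ] at h2
  rw [h2]
  have h3 := hP.orth hΛ a (hP.X_mul_sub_mem i n b)
  rw [mul_sub, map_sub, sub_eq_zero] at h3
  exact h3.symm

lemma sumC_mul_gram (hP : IsMonicOPS Ω u P) (hΛ : IsIntegral Ω u Λ) (n : ℕ)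
    (a : Fin (n + 2)) (b : Fin (n + 1)) :
    ∑ c, sumC Ω u P n a c * Λ (P n c * P n b) = Λ ((X 0 + X 1) * P (n + 1) a * P n b) := by
  simp only [sumC, Matrix.add_apply, add_mul, Finset.sum_add_distrib, coefC_mul_gram hP hΛ,
    ← map_add]
  congr 1
  ring

/-- The polynomial `C_(n+1) ℙ_n` is the orthogonal projection of `(x + y) ℙ_(n+1)` to the
polynomials of degree `≤ n`. -/
lemma inner_sumC (hP : IsMonicOPS Ω u P) (hΛ : IsIntegral Ω u Λ) (n : ℕ)
    (a : Fin (n + 2)) {p : Poly₂} (hp : p ∈ degLT (n + 1)) :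
    Λ ((∑ c, C (sumC Ω u P n a c) * P n c) * p) = Λ ((X 0 + X 1) * P (n + 1) a * p) := by
  rw [← sub_eq_zero, ← map_sub, ← sub_mul]
  refine hP.map_eq_zero (Λ ∘ₗ LinearMap.mulLeft ℝ _) (fun k hk b => ?_) hp
  simp only [LinearMap.comp_apply, LinearMap.mulLeft_apply]
  rw [sub_mul, map_sub, sub_eq_zero, Finset.sum_mul, map_sum]
  simp only [mul_assoc, C_mul', smul_mul_assoc, map_smul, smul_eq_mul]
  rcases Nat.lt_succ_iff_lt_or_eq.1 hk with h | rfl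
  · have h1 : ∀ c, Λ (P n c * P k b) = 0 := fun c =>
      hP.orth hΛ c (degLT_mono (by omega) (hP.mem k b))
    have h2 : (X 0 + X 1) * P k b ∈ degLT (n + 1) := by
      rw [add_mul]
      exact Submodule.add_mem _ (degLT_mono (by omega) (X_mul_mem_degLT 0 (hP.mem k b)))
        (degLT_mono (by omega) (X_mul_mem_degLT 1 (hP.mem k b)))
    have h3 := hP.orth hΛ a h2
    rw [mul_left_comm] at h3
    simp [h1, h3]
  · rw [sumC_mul_gram hP hΛ, mul_assoc]

/-- The three term relation for `ℙ_0`: the difference of the two sides has degree `< 1` and is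
orthogonal to `ℙ_0`. -/
lemma three_term_zero (hP : IsMonicOPS Ω u P) (hΛ : IsIntegral Ω u Λ) (i : Fin 2)
    (a : Fin 1) :
    X i * P 0 a = P 1 (shiftIdx i a) + ∑ c, coefD Ω u P i 0 a c • P 0 c := by
  rw [← sub_eq_zero, ← sub_sub]
  refine hP.eq_zero_of_orth hΛ (n := 1) ?_ ?_
  · exact Submodule.sub_mem _ (hP.X_mul_sub_mem i 0 a)
      (Submodule.sum_mem _ fun c _ => Submodule.smul_mem _ _ (hP.mem 0 c))
  · intro k hk b
    obtain rfl : k = 0 := by omega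
    simp only [sub_mul, map_sub, Finset.sum_mul, map_sum, smul_mul_assoc, map_smul, smul_eq_mul]
    rw [coefD_mul_gram hP hΛ, hP.orth hΛ _ (hP.mem 0 b)]
    ring

/-- The three term relation for `ℙ_(n+1)`: the difference of the two sides has degree `< n + 2` and
is orthogonal to `ℙ_0, …, ℙ_(n+1)`. -/
lemma three_term_succ (hP : IsMonicOPS Ω u P) (hΛ : IsIntegral Ω u Λ) (i : Fin 2) (n : ℕ)
    (a : Fin (n + 2)) :
    X i * P (n + 1) a = P (n + 2) (shiftIdx i a) + ∑ c, coefD Ω u P i (n + 1) a c • P (n + 1) c +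
      ∑ c, coefC Ω u P i n a c • P n c := by
  rw [← sub_eq_zero, ← sub_sub, ← sub_sub]
  refine hP.eq_zero_of_orth hΛ (n := n + 2) ?_ ?_
  · exact Submodule.sub_mem _ (Submodule.sub_mem _ (hP.X_mul_sub_mem i (n + 1) a)
      (Submodule.sum_mem _ fun c _ => Submodule.smul_mem _ _ (hP.mem (n + 1) c)))
      (Submodule.sum_mem _ fun c _ => Submodule.smul_mem _ _
        (degLT_mono (by omega) (hP.mem n c)))
  · intro k hk b
    simp only [sub_mul, map_sub, Finset.sum_mul, map_sum, smul_mul_assoc, map_smul, smul_eq_mul]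
    rw [hP.orth hΛ (shiftIdx i a) (degLT_mono (by omega) (hP.mem k b))]
    have hcomm : X i * P (n + 1) a * P k b = P (n + 1) a * (X i * P k b) := by ring
    rcases Nat.lt_succ_iff_lt_or_eq.1 hk with h | rfl
    · have h1 : ∀ c, Λ (P (n + 1) c * P k b) = 0 := fun c =>
        hP.orth hΛ c (degLT_mono (by omega) (hP.mem k b))
      rcases Nat.lt_succ_iff_lt_or_eq.1 h with h | rfl
      · have h2 : ∀ c, Λ (P n c * P k b) = 0 := fun c =>
          hP.orth hΛ c (degLT_mono (by omega) (hP.mem k b))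
        rw [hcomm, hP.orth hΛ a (degLT_mono (by omega) (X_mul_mem_degLT i (hP.mem k b)))]
        simp [h1, h2]
      · rw [coefC_mul_gram hP hΛ, hcomm]
        simp [h1]
    · have h1 : ∀ c, Λ (P n c * P (n + 1) b) = 0 := fun c => by
        rw [mul_comm]; exact hP.orth hΛ b (hP.mem n c)
      rw [coefD_mul_gram hP hΛ]
      simp [h1]

/-- The entries of a monic orthogonal system are linearly independent. -/
lemma IsMonicOPS.coeff_eq_zero (hP : IsMonicOPS Ω u P) (hΛ : IsIntegral Ω u Λ)
    (T : Finset ℕ) (v : BlockIdx → ℝ)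
    (h : ∑ n ∈ T, ∑ a, v ⟨n, a⟩ • P n a = 0) {n : ℕ} (hn : n ∈ T) (a : Fin (n + 1)) :
    v ⟨n, a⟩ = 0 := by
  have h1 : ∀ b, ∑ c, v ⟨n, c⟩ * Λ (P n c * P n b) = 0 := by
    intro b
    have h2 := congrArg (fun q => Λ (q * P n b)) h
    simp only [Finset.sum_mul, map_sum, smul_mul_assoc, map_smul, smul_eq_mul, zero_mul,
      map_zero] at h2
    rwa [Finset.sum_eq_single_of_mem n hn] at h2
    intro k _ hk
    refine Finset.sum_eq_zero fun c _ => ?_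
    rw [← hΛ.inner, hP.orthogonal k n hk, mul_zero]
  have h3 : Matrix.vecMul (fun c => v ⟨n, c⟩) (gram Ω u P n) = 0 := by
    ext b
    simpa [Matrix.vecMul, dotProduct, IsMonicOPS.gram_apply hΛ] using h1 b
  exact congrFun (Matrix.eq_zero_of_vecMul_eq_zero (hP.isUnit_det n).ne_zero h3) a

lemma coefD_zero (hP : IsMonicOPS Ω u P) (hΛ : IsIntegral Ω u Λ) (i : Fin 2) (a b : Fin 1) :
    coefD Ω u P i 0 a b = Λ (X i) := by
  have h := coefD_mul_gram hP hΛ i 0 a b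
  simp only [hP.zero, mul_one, hΛ.one, Fin.sum_univ_succ, Fin.sum_univ_zero, add_zero] at h
  rw [← h, Subsingleton.elim b 0]

lemma sumD_zero (hP : IsMonicOPS Ω u P) (hΛ : IsIntegral Ω u Λ) (a b : Fin 1) :
    sumD Ω u P 0 a b = Λ (X 0 + X 1) := by
  rw [sumD, Matrix.add_apply, coefD_zero hP hΛ, coefD_zero hP hΛ, map_add]

/-- The entries of the matrices `D_(1,j)` determine the numbers `D_(0,i)`: compare the expansions
of `x (y ℙ_0)` and `y (x ℙ_0)`. -/
lemma coefD_one_compat (hP : IsMonicOPS Ω u P) (hΛ : IsIntegral Ω u Λ) (c : Fin 2) :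
    coefD Ω u P 0 1 1 c + coefD Ω u P 1 0 0 0 * (1 : Matrix (Fin 2) (Fin 2) ℝ) 0 c =
      coefD Ω u P 1 1 0 c + coefD Ω u P 0 0 0 0 * (1 : Matrix (Fin 2) (Fin 2) ℝ) 1 c := by
  have key : ∀ i j : Fin 2, ∀ b, ∑ c, (coefD Ω u P i 1 j c +
      coefD Ω u P j 0 0 0 * (1 : Matrix (Fin 2) (Fin 2) ℝ) i c) * gram Ω u P 1 c b =
      Λ (X i * X j * P 1 b) := by
    intro i j b
    have h0 : ∀ l : Fin 2, (X l : Poly₂) = P 1 l + C (coefD Ω u P l 0 0 0) := by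
      intro l
      have h := three_term_zero hP hΛ l 0
      simp only [hP.zero, mul_one, Fin.sum_univ_succ, Fin.sum_univ_zero, add_zero] at h
      rw [h, ← C_mul', mul_one]
      congr 2
      simp [shiftIdx]
    simp only [add_mul, Finset.sum_add_distrib, mul_assoc, ← Finset.mul_sum]
    simp only [Matrix.one_apply, ite_mul, one_mul, zero_mul, Finset.sum_ite_eq, Finset.mem_univ,
      if_true, IsMonicOPS.gram_apply hΛ]
    rw [coefD_mul_gram hP hΛ]
    have e1 : X i * (X j * P 1 b) = X i * P 1 j * P 1 b +
        coefD Ω u P j 0 0 0 • ((P 1 i + C (coefD Ω u P i 0 0 0)) * P 1 b) := by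
      rw [← h0 i]
      conv_lhs => rw [h0 j]
      rw [← C_mul']
      ring
    have e2 : Λ (C (coefD Ω u P i 0 0 0) * P 1 b) = 0 := by
      rw [mul_comm]
      exact hP.orth hΛ b (C_mem_degLT _)
    rw [e1, map_add, map_smul, add_mul, map_add, e2, add_zero, smul_eq_mul]
  have h1 : Matrix.vecMul (fun c => (coefD Ω u P 0 1 1 c +
      coefD Ω u P 1 0 0 0 * (1 : Matrix (Fin 2) (Fin 2) ℝ) 0 c) - (coefD Ω u P 1 1 0 c +
      coefD Ω u P 0 0 0 0 * (1 : Matrix (Fin 2) (Fin 2) ℝ) 1 c)) (gram Ω u P 1) = 0 := by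
    ext b
    have k1 := key 0 1 b
    have k2 := key 1 0 b
    rw [mul_comm (X 1) (X 0), ← k1, ← sub_eq_zero, ← Finset.sum_sub_distrib] at k2
    simp only [Matrix.vecMul, dotProduct, Pi.zero_apply]
    rw [← neg_eq_zero, ← k2, ← Finset.sum_neg_distrib]
    refine Finset.sum_congr rfl fun c _ => ?_
    ring
  exact sub_eq_zero.1 (congrFun (Matrix.eq_zero_of_vecMul_eq_zero (hP.isUnit_det 1).ne_zero h1) c)

/-- `C_(n+2) C_(n+1,i) = C_(n+2,i) C_(n+1)`. -/
lemma sumC_mul_coefC (hP : IsMonicOPS Ω u P) (i : Fin 2) (n : ℕ) :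
    sumC Ω u P (n + 1) * coefC Ω u P i n = coefC Ω u P i (n + 1) * sumC Ω u P n := by
  have key : ∀ i j : Fin 2, coefC Ω u P i (n + 1) * coefC Ω u P j n =
      gram Ω u P (n + 2) * (shiftL j n * shiftL i (n + 1)).transpose * (gram Ω u P n)⁻¹ := by
    intro i j
    simp only [coefC, Matrix.transpose_mul, Matrix.mul_assoc]
    rw [Matrix.nonsing_inv_mul_cancel_left _ _ (hP.isUnit_det (n + 1))]
  have hcomm : ∀ i j : Fin 2, shiftL i n * shiftL j (n + 1) = shiftL j n * shiftL i (n + 1) := by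
    intro i j
    ext a b
    rw [shiftL_mul, shiftL_mul]
    simp [shiftL, shiftIdx, add_right_comm]
  simp only [sumC, Matrix.add_mul, Matrix.mul_add, key, hcomm _ i]

/-! ### Infinite block matrices with finite rows -/

/-- Row block `n` of `M` vanishes beyond column block `n + k`. -/
def RowBounded (k : ℕ) (M : BlockMat) : Prop := ∀ r c : BlockIdx, r.1 + k < c.1 → M r c = 0

/-- The positions in the blocks `0, …, N - 1`. -/
def upTo (N : ℕ) : Finset BlockIdx := (Finset.range N).sigma fun _ => Finset.univ

lemma mem_upTo {N : ℕ} {s : BlockIdx} : s ∈ upTo N ↔ s.1 < N := by simp [upTo]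

/-- The product `M v` of an infinite block matrix and a column with entries in a vector space.
Like `infMul`, it is meant for matrices with finitely many nonzero entries in each row. -/
def rowAct {E : Type*} [AddCommGroup E] [Module ℝ E] (M : BlockMat) (v : BlockIdx → E)
    (r : BlockIdx) : E := ∑ᶠ s, M r s • v s

section Matrices

variable {E : Type*} [AddCommGroup E] [Module ℝ E] {k l N : ℕ} {M M' Q : BlockMat}

lemma infMul_apply (M Q : BlockMat) (r c : BlockIdx) :
    infMul M Q r c = rowAct M (fun s => Q s c) r := rfl

lemma rowAct_eq_sum (hM : RowBounded k M) (v : BlockIdx → E) {r : BlockIdx} (h : r.1 + k < N) :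
    rowAct M v r = ∑ s ∈ upTo N, M r s • v s := by
  refine finsum_eq_sum_of_support_subset _ fun s hs => ?_
  rw [Finset.mem_coe, mem_upTo]
  by_contra hc
  exact hs (by simp [hM r s (by omega)])

lemma infMul_eq_sum (hM : RowBounded k M) (Q : BlockMat) {r : BlockIdx} (c : BlockIdx)
    (h : r.1 + k < N) : infMul M Q r c = ∑ s ∈ upTo N, M r s * Q s c := by
  rw [infMul_apply, rowAct_eq_sum hM _ h]
  rfl

lemma RowBounded.mono (hM : RowBounded k M) (h : k ≤ l) : RowBounded l M :=
  fun r c hr => hM r c (by omega)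

lemma RowBounded.sub (hM : RowBounded k M) (hQ : RowBounded k Q) : RowBounded k (M - Q) :=
  fun r c h => by rw [Matrix.sub_apply, hM r c h, hQ r c h, sub_zero]

lemma RowBounded.infMul (hM : RowBounded k M) (hQ : RowBounded l Q) :
    RowBounded (k + l) (infMul M Q) := by
  intro r c h
  rw [infMul_eq_sum hM Q c (Nat.lt_succ_self _)]
  refine Finset.sum_eq_zero fun s hs => ?_
  rw [mem_upTo] at hs
  rw [hQ s c (by omega), mul_zero]

lemma RowBounded.infComm (hM : RowBounded k M) (hQ : RowBounded l Q) :
    RowBounded (k + l) (infComm M Q) :=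
  (hM.infMul hQ).sub (by rw [add_comm]; exact hQ.infMul hM)

lemma rowBounded_one : RowBounded 0 1 := fun r c h =>
  Matrix.one_apply_ne (by rintro rfl; omega)

lemma rowAct_one (v : BlockIdx → E) : rowAct 1 v = v := by
  ext r
  rw [rowAct, finsum_eq_single _ r]
  · simp
  · intro s hs
    simp [Matrix.one_apply_ne hs.symm]

lemma one_infMul (M : BlockMat) : Toda2D.infMul 1 M = M := by
  ext r c
  rw [infMul_apply, rowAct_one]

lemma infMul_one (M : BlockMat) : Toda2D.infMul M 1 = M := by
  ext r c
  rw [infMul_apply, rowAct, finsum_eq_single _ c]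
  · simp
  · intro s hs
    simp [Matrix.one_apply_ne hs]

lemma rowAct_infMul (hM : RowBounded k M) (hQ : RowBounded l Q) (v : BlockIdx → E) :
    rowAct (infMul M Q) v = rowAct M (rowAct Q v) := by
  ext r
  rw [rowAct_eq_sum (hM.infMul hQ) v (Nat.lt_succ_self _),
    rowAct_eq_sum hM _ (Nat.lt_succ_self _)]
  have h1 : ∀ s ∈ upTo (r.1 + k).succ, M r s • rowAct Q v s =
      ∑ x ∈ upTo (r.1 + (k + l)).succ, (M r s * Q s x) • v x := by
    intro s hs
    rw [mem_upTo] at hs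
    rw [rowAct_eq_sum hQ v (N := (r.1 + (k + l)).succ) (by omega), Finset.smul_sum]
    simp only [mul_smul]
  rw [Finset.sum_congr rfl h1, Finset.sum_comm]
  refine Finset.sum_congr rfl fun x _ => ?_
  rw [infMul_eq_sum hM Q x (Nat.lt_succ_self _), Finset.sum_smul]

lemma infMul_assoc (hM : RowBounded k M) (hM' : RowBounded l M') (Q : BlockMat) :
    infMul (infMul M M') Q = infMul M (infMul M' Q) := by
  ext r c
  exact congrFun (rowAct_infMul hM hM' fun s => Q s c) r

lemma sub_rowAct (hM : RowBounded k M) (hM' : RowBounded k M') (v : BlockIdx → E)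
    (r : BlockIdx) : rowAct (M - M') v r = rowAct M v r - rowAct M' v r := by
  rw [rowAct_eq_sum (hM.sub hM') v (Nat.lt_succ_self _),
    rowAct_eq_sum hM v (Nat.lt_succ_self _), rowAct_eq_sum hM' v (Nat.lt_succ_self _),
    ← Finset.sum_sub_distrib]
  simp only [Matrix.sub_apply, sub_smul]

lemma sub_infMul (hM : RowBounded k M) (hM' : RowBounded k M') (Q : BlockMat) :
    infMul (M - M') Q = infMul M Q - infMul M' Q := by
  ext r c
  exact sub_rowAct hM hM' (fun s => Q s c) r

lemma infMul_sub (hM : RowBounded k M) (Q Q' : BlockMat) :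
    infMul M (Q - Q') = infMul M Q - infMul M Q' := by
  ext r c
  simp only [Matrix.sub_apply, infMul_eq_sum hM _ c (Nat.lt_succ_self _), mul_sub,
    Finset.sum_sub_distrib]

/-- The commutator with a fixed matrix is a derivation. -/
lemma infComm_infMul {A : BlockMat} {j : ℕ} (hA : RowBounded j A) (hM : RowBounded k M)
    (hQ : RowBounded l Q) :
    infComm A (infMul M Q) = infMul (infComm A M) Q + infMul M (infComm A Q) := by
  have h1 : RowBounded (j + k) (infMul M A) := by
    rw [add_comm]
    exact hM.infMul hA
  rw [infComm, infComm, infComm, sub_infMul (hA.infMul hM) h1, infMul_sub hM,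
    infMul_assoc hA hM, infMul_assoc hM hA, infMul_assoc hM hQ]
  abel

lemma infComm_one (A : BlockMat) : infComm A 1 = 0 := by
  rw [infComm, infMul_one, one_infMul, sub_self]

lemma RowBounded.infPow (hM : RowBounded k M) (n : ℕ) : RowBounded (n * k) (infPow M n) := by
  induction n with
  | zero => exact rowBounded_one.mono (by omega)
  | succ n ih =>
    rw [Nat.succ_mul]
    exact ih.infMul hM

end Matrices

/-- The product rule for infinite matrices with uniformly bounded rows. -/
lemma HasEntryDeriv.infMul {M Q : ℝ → BlockMat} {M' Q' : BlockMat} {t : ℝ} {k : ℕ} (ht : 0 ≤ t)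
    (hM : HasEntryDeriv M M' t) (hQ : HasEntryDeriv Q Q' t)
    (hb : ∀ s, 0 ≤ s → RowBounded k (M s)) (hb' : RowBounded k M') :
    HasEntryDeriv (fun s => infMul (M s) (Q s)) (infMul M' (Q t) + infMul (M t) Q') t := by
  intro r c
  have h := HasDerivWithinAt.fun_sum (u := upTo (r.1 + k + 1))
    fun s (_ : s ∈ upTo (r.1 + k + 1)) => (hM r s).mul (hQ s c)
  rw [Finset.sum_add_distrib, ← infMul_eq_sum hb' _ _ (Nat.lt_succ_self _),
    ← infMul_eq_sum (hb t ht) _ _ (Nat.lt_succ_self _)] at h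
  refine h.congr (fun s hs => ?_) ?_
  · exact infMul_eq_sum (hb s hs) _ _ (Nat.lt_succ_self _)
  · exact infMul_eq_sum (hb t ht) _ _ (Nat.lt_succ_self _)

/-- If `Ṁ = [A, M]` and `Q̇ = [A, Q]`, then `(M Q)˙ = [A, M Q]`. -/
lemma HasEntryDeriv.lax_infMul {M Q : ℝ → BlockMat} {A : BlockMat} {t : ℝ} {j k l : ℕ}
    (ht : 0 ≤ t) (hA : RowBounded j A) (hM : HasEntryDeriv M (infComm A (M t)) t)
    (hQ : HasEntryDeriv Q (infComm A (Q t)) t) (hb : ∀ s, 0 ≤ s → RowBounded k (M s))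
    (hb' : ∀ s, 0 ≤ s → RowBounded l (Q s)) :
    HasEntryDeriv (fun s => Toda2D.infMul (M s) (Q s))
      (infComm A (Toda2D.infMul (M t) (Q t))) t := by
  rw [infComm_infMul hA (hb t ht) (hb' t ht)]
  exact hM.infMul ht hQ (fun s hs => (hb s hs).mono (Nat.le_add_left k j)) (hA.infComm (hb t ht))

lemma HasEntryDeriv.lax_infPow {M : ℝ → BlockMat} {A : BlockMat} {t : ℝ} {j k : ℕ}
    (ht : 0 ≤ t) (hA : RowBounded j A) (hM : HasEntryDeriv M (infComm A (M t)) t)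
    (hb : ∀ s, 0 ≤ s → RowBounded k (M s)) (n : ℕ) :
    HasEntryDeriv (fun s => infPow (M s) n) (infComm A (infPow (M t) n)) t := by
  induction n with
  | zero =>
    simp only [infPow, infComm_one]
    exact fun r c => hasDerivWithinAt_const _ _ _
  | succ n ih => exact ih.lax_infMul ht hA hM (fun s hs => (hb s hs).infPow n) hb

/-! ### The matrices `J_i` and `A` -/

section Entries

variable (Ω : Set (Fin 2 → ℝ)) (u : (Fin 2 → ℝ) → ℝ) (P : PolySeq) (i : Fin 2)

lemma jacobi_diag (n : ℕ) (a b : Fin (n + 1)) :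
    jacobi Ω u P i ⟨n, a⟩ ⟨n, b⟩ = coefD Ω u P i n a b := by
  simp [jacobi]

lemma jacobi_lower (n : ℕ) (a : Fin (n + 2)) (b : Fin (n + 1)) :
    jacobi Ω u P i ⟨n + 1, a⟩ ⟨n, b⟩ = coefC Ω u P i n a b := by
  simp [jacobi]

lemma jacobi_upper (n : ℕ) (a : Fin (n + 1)) (b : Fin (n + 2)) :
    jacobi Ω u P i ⟨n, a⟩ ⟨n + 1, b⟩ = shiftL i n a b := by
  have h : ¬ n = n + 1 + 1 := by omega
  simp [jacobi, h]

lemma jacobi_eq_zero {r c : BlockIdx} (h : r.1 + 1 < c.1 ∨ c.1 + 1 < r.1) :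
    jacobi Ω u P i r c = 0 := by
  have h1 : ¬ c.1 = r.1 := by omega
  have h2 : ¬ r.1 = c.1 + 1 := by omega
  have h3 : ¬ c.1 = r.1 + 1 := by omega
  simp [jacobi, h1, h2, h3]

lemma rowBounded_jacobi : RowBounded 1 (jacobi Ω u P i) := fun _ _ h =>
  jacobi_eq_zero Ω u P i (Or.inl h)

lemma rowBounded_matA : RowBounded 0 (matA Ω u P) := fun r c h => by
  have h1 : ¬ r.1 = c.1 + 1 := by omega
  simp [matA, h1]

variable {E : Type*} [AddCommGroup E] [Module ℝ E]

lemma rowAct_matA_zero (v : BlockIdx → E) (a : Fin 1) : rowAct (matA Ω u P) v ⟨0, a⟩ = 0 := by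
  have h : ∀ s, matA Ω u P ⟨0, a⟩ s = 0 := fun s => by simp [matA]
  simp [rowAct, h]

lemma rowAct_matA_succ (v : BlockIdx → E) (n : ℕ) (a : Fin (n + 2)) :
    rowAct (matA Ω u P) v ⟨n + 1, a⟩ = ∑ c, sumC Ω u P n a c • v ⟨n, c⟩ := by
  rw [rowAct_eq_sum (rowBounded_matA Ω u P) v (N := n + 2) (by simp), upTo, Finset.sum_sigma,
    Finset.sum_eq_single_of_mem n (by simp)]
  · simp [matA]
  · intro k _ hk
    refine Finset.sum_eq_zero fun c _ => ?_
    have h1 : ¬ n = k := fun h => hk h.symm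
    simp [matA, h1]

lemma infMul_matA_right (M : BlockMat) (r : BlockIdx) (m : ℕ) (b : Fin (m + 1)) :
    infMul M (matA Ω u P) r ⟨m, b⟩ = ∑ a, M r ⟨m + 1, a⟩ * sumC Ω u P m a b := by
  have h : infMul M (matA Ω u P) r ⟨m, b⟩ =
      ∑ s ∈ upTo (m + 2), M r s * matA Ω u P s ⟨m, b⟩ := by
    refine finsum_eq_sum_of_support_subset _ fun s hs => ?_
    rw [Finset.mem_coe, mem_upTo]
    by_contra hc
    have h1 : ¬ s.1 = m + 1 := by omega
    exact hs (by simp [matA, h1])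
  rw [h, upTo, Finset.sum_sigma, Finset.sum_eq_single_of_mem (m + 1) (by simp)]
  · simp [matA]
  · intro k _ hk
    refine Finset.sum_eq_zero fun c _ => ?_
    simp [matA, hk]

lemma infComm_zero_zero (a b : Fin 1) :
    infComm (matA Ω u P) (jacobi Ω u P i) ⟨0, a⟩ ⟨0, b⟩ = -sumC Ω u P 0 (shiftIdx i a) b := by
  rw [infComm, Matrix.sub_apply, infMul_apply, rowAct_matA_zero, infMul_matA_right]
  simp only [jacobi_upper, zero_sub]
  rw [← Matrix.mul_apply, shiftL_mul]

lemma infComm_diag (n : ℕ) (a b : Fin (n + 2)) :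
    infComm (matA Ω u P) (jacobi Ω u P i) ⟨n + 1, a⟩ ⟨n + 1, b⟩ =
      (sumC Ω u P n * shiftL i n - shiftL i (n + 1) * sumC Ω u P (n + 1)) a b := by
  rw [infComm, Matrix.sub_apply, infMul_apply, rowAct_matA_succ, infMul_matA_right]
  simp only [jacobi_upper, Matrix.sub_apply, Matrix.mul_apply, smul_eq_mul]

lemma infComm_lower (n : ℕ) (a : Fin (n + 2)) (b : Fin (n + 1)) :
    infComm (matA Ω u P) (jacobi Ω u P i) ⟨n + 1, a⟩ ⟨n, b⟩ =
      (sumC Ω u P n * coefD Ω u P i n - coefD Ω u P i (n + 1) * sumC Ω u P n) a b := by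
  rw [infComm, Matrix.sub_apply, infMul_apply, rowAct_matA_succ, infMul_matA_right]
  simp only [jacobi_diag, Matrix.sub_apply, Matrix.mul_apply, smul_eq_mul]

lemma infComm_eq_zero (hP : IsMonicOPS Ω u P) {r c : BlockIdx}
    (h : r.1 < c.1 ∨ c.1 + 1 < r.1) :
    infComm (matA Ω u P) (jacobi Ω u P i) r c = 0 := by
  obtain ⟨n, a⟩ := r
  obtain ⟨m, b⟩ := c
  simp only at h
  by_cases hn : n = m + 2
  · subst hn
    rw [infComm, Matrix.sub_apply, infMul_apply, rowAct_matA_succ, infMul_matA_right]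
    simp only [jacobi_lower, smul_eq_mul]
    rw [← Matrix.mul_apply, ← Matrix.mul_apply, sumC_mul_coefC hP, sub_self]
  · rw [infComm, Matrix.sub_apply, infMul_apply, infMul_matA_right]
    have h2 : ∀ x, jacobi Ω u P i ⟨n, a⟩ ⟨m + 1, x⟩ = 0 := fun x =>
      jacobi_eq_zero Ω u P i (by simp only; omega)
    cases n with
    | zero => simp [rowAct_matA_zero, h2]
    | succ n =>
      have h1 : ∀ x, jacobi Ω u P i ⟨n, x⟩ ⟨m, b⟩ = 0 := fun x =>
        jacobi_eq_zero Ω u P i (by simp only; omega)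
      simp [rowAct_matA_succ, h1, h2]

end Entries

section Action

variable {Ω : Set (Fin 2 → ℝ)} {u : (Fin 2 → ℝ) → ℝ} {P : PolySeq} {Λ : Poly₂ →ₗ[ℝ] ℝ}

/-- The three term relations in matrix form: `J_i ℙ = x_i ℙ`. -/
lemma rowAct_jacobi (hP : IsMonicOPS Ω u P) (hΛ : IsIntegral Ω u Λ) (i : Fin 2) (r : BlockIdx) :
    rowAct (jacobi Ω u P i) (entries P) r = X i * entries P r := by
  obtain ⟨n, a⟩ := r
  rw [rowAct_eq_sum (rowBounded_jacobi Ω u P i) _ (N := n + 2) (by simp), upTo, Finset.sum_sigma]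
  cases n with
  | zero =>
    rw [Finset.sum_range_succ, Finset.sum_range_succ, Finset.sum_range_zero]
    simp only [jacobi_diag, jacobi_upper, entries]
    rw [sum_shiftL, three_term_zero hP hΛ]
    ring
  | succ n =>
    rw [Finset.sum_range_succ, Finset.sum_range_succ, Finset.sum_range_succ, Finset.sum_eq_zero]
    · simp only [jacobi_diag, jacobi_upper, jacobi_lower, entries]
      rw [sum_shiftL, three_term_succ hP hΛ]
      ring
    · intro k hk
      rw [Finset.mem_range] at hk
      refine Finset.sum_eq_zero fun c _ => ?_
      rw [jacobi_eq_zero Ω u P i (by simp only; omega), zero_smul]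

/-- Scalar polynomials commute with infinite matrices. -/
lemma rowAct_mul_left {k : ℕ} {M : BlockMat} (hM : RowBounded k M) (q : Poly₂)
    (v : BlockIdx → Poly₂) (r : BlockIdx) :
    rowAct M (fun s => q * v s) r = q * rowAct M v r := by
  rw [rowAct_eq_sum hM _ (Nat.lt_succ_self _), rowAct_eq_sum hM _ (Nat.lt_succ_self _),
    Finset.mul_sum]
  simp only [mul_smul_comm]

lemma rowAct_infPow_jacobi (hP : IsMonicOPS Ω u P) (hΛ : IsIntegral Ω u Λ) (i : Fin 2) (n : ℕ)
    (r : BlockIdx) :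
    rowAct (infPow (jacobi Ω u P i) n) (entries P) r = X i ^ n * entries P r := by
  induction n generalizing r with
  | zero => simp [infPow, rowAct_one]
  | succ n ih =>
    have hb := (rowBounded_jacobi Ω u P i).infPow n
    rw [infPow, rowAct_infMul hb (rowBounded_jacobi Ω u P i),
      funext (rowAct_jacobi hP hΛ i), rowAct_mul_left hb, ih, pow_succ']
    ring

/-- `J_1^h J_2^k`. -/
def jacobiMonomial (Ω : Set (Fin 2 → ℝ)) (u : (Fin 2 → ℝ) → ℝ) (P : PolySeq) (h k : ℕ) :
    BlockMat :=
  infMul (infPow (jacobi Ω u P 0) h) (infPow (jacobi Ω u P 1) k)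

lemma rowBounded_jacobiMonomial (Ω : Set (Fin 2 → ℝ)) (u : (Fin 2 → ℝ) → ℝ) (P : PolySeq)
    (h k : ℕ) : RowBounded (h * 1 + k * 1) (jacobiMonomial Ω u P h k) :=
  ((rowBounded_jacobi Ω u P 0).infPow h).infMul ((rowBounded_jacobi Ω u P 1).infPow k)

lemma rowAct_jacobiMonomial (hP : IsMonicOPS Ω u P) (hΛ : IsIntegral Ω u Λ) (h k : ℕ)
    (r : BlockIdx) :
    rowAct (jacobiMonomial Ω u P h k) (entries P) r = X 0 ^ h * X 1 ^ k * entries P r := by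
  have hb := (rowBounded_jacobi Ω u P 0).infPow h
  rw [jacobiMonomial, rowAct_infMul hb ((rowBounded_jacobi Ω u P 1).infPow k),
    funext (rowAct_infPow_jacobi hP hΛ 1 k), rowAct_mul_left hb, rowAct_infPow_jacobi hP hΛ]
  ring

/-- A matrix with bounded rows that annihilates the orthogonal system is zero. -/
lemma eq_zero_of_rowAct {k : ℕ} {M : BlockMat} (hP : IsMonicOPS Ω u P) (hΛ : IsIntegral Ω u Λ)
    (hM : RowBounded k M) {r : BlockIdx} (h : rowAct M (entries P) r = 0) (c : BlockIdx) :
    M r c = 0 := by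
  by_cases hc : r.1 + k < c.1
  · exact hM r c hc
  · rw [rowAct_eq_sum hM _ (Nat.lt_succ_self _), upTo, Finset.sum_sigma] at h
    exact hP.coeff_eq_zero hΛ _ (fun s => M r s) h (n := c.1) (by simp; omega) c.2

lemma entry_zero_zero {j : ℕ} {M : BlockMat} (hP : IsMonicOPS Ω u P) (hΛ : IsIntegral Ω u Λ)
    (hM : RowBounded j M) : M ⟨0, 0⟩ ⟨0, 0⟩ = Λ (rowAct M (entries P) ⟨0, 0⟩) := by
  rw [rowAct_eq_sum hM _ (Nat.lt_succ_self _), upTo, Finset.sum_sigma, Finset.sum_range_succ',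
    map_add, map_sum, Finset.sum_eq_zero]
  · simp [entries, hP.zero, hΛ.one]
  · intro n _
    rw [map_sum]
    refine Finset.sum_eq_zero fun a _ => ?_
    have h := hP.orth hΛ a (degLT_mono (by omega) (C_mem_degLT 1) : C 1 ∈ degLT (n + 1))
    rw [map_one, mul_one] at h
    rw [map_smul, entries, h, smul_zero]

/-- The moments are the entries of the matrices `J_1^h J_2^k` at the position `(0, 0)`. -/
lemma jacobiMonomial_zero_zero (hP : IsMonicOPS Ω u P) (hΛ : IsIntegral Ω u Λ) (h k : ℕ) :
    jacobiMonomial Ω u P h k ⟨0, 0⟩ ⟨0, 0⟩ = moment Ω u h k := by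
  rw [entry_zero_zero hP hΛ (rowBounded_jacobiMonomial Ω u P h k),
    rowAct_jacobiMonomial hP hΛ, hΛ.moment, entries, hP.zero, mul_one]

lemma infComm_entry_zero_zero {j : ℕ} {M : BlockMat} (hP : IsMonicOPS Ω u P)
    (hΛ : IsIntegral Ω u Λ) (hM : RowBounded j M) :
    infComm (matA Ω u P) M ⟨0, 0⟩ ⟨0, 0⟩ = -Λ ((X 0 + X 1) * rowAct M (entries P) ⟨0, 0⟩) +
      M ⟨0, 0⟩ ⟨0, 0⟩ * Λ (X 0 + X 1) := by
  have hX : (X 0 + X 1 : Poly₂) ∈ degLT 2 := Submodule.add_mem _ (X_mem_degLT 0) (X_mem_degLT 1)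
  have hC : ∀ a, sumC Ω u P 0 a 0 = Λ ((X 0 + X 1) * P 1 a) := by
    intro a
    have h := sumC_mul_gram hP hΛ 0 a 0
    simpa only [hP.zero, mul_one, hΛ.one, Fin.sum_univ_succ, Fin.sum_univ_zero, add_zero] using h
  have hsum : Λ ((X 0 + X 1) * rowAct M (entries P) ⟨0, 0⟩) = ∑ n ∈ Finset.range (j + 2),
      ∑ a, M ⟨0, 0⟩ ⟨n, a⟩ * Λ ((X 0 + X 1) * P n a) := by
    rw [rowAct_eq_sum hM _ (N := j + 2) (by simp), upTo, Finset.sum_sigma]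
    simp only [Finset.mul_sum, map_sum, mul_smul_comm, map_smul, smul_eq_mul, entries]
  have hzero : ∑ n ∈ Finset.range j,
      ∑ a, M ⟨0, 0⟩ ⟨n + 2, a⟩ * Λ ((X 0 + X 1) * P (n + 2) a) = 0 := by
    refine Finset.sum_eq_zero fun n _ => Finset.sum_eq_zero fun a _ => ?_
    rw [mul_comm (X 0 + X 1), hP.orth hΛ a (degLT_mono (by omega) hX), mul_zero]
  rw [hsum, Finset.sum_range_succ', Finset.sum_range_succ', hzero, infComm, Matrix.sub_apply,
    infMul_apply, rowAct_matA_zero, infMul_matA_right]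
  simp only [hP.zero, mul_one, hC, Fin.sum_univ_succ, Fin.sum_univ_zero, add_zero, zero_add]
  ring

/-- The `(0, 0)` entry of `[A, J_1^h J_2^k]` is the right-hand side of the evolution of
the moment `ω_(h,k)`. -/
lemma infComm_jacobiMonomial_zero_zero (hP : IsMonicOPS Ω u P) (hΛ : IsIntegral Ω u Λ)
    (h k : ℕ) :
    infComm (matA Ω u P) (jacobiMonomial Ω u P h k) ⟨0, 0⟩ ⟨0, 0⟩ =
      -moment Ω u (h + 1) k - moment Ω u h (k + 1) +
        moment Ω u h k * (moment Ω u 1 0 + moment Ω u 0 1) := by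
  rw [infComm_entry_zero_zero hP hΛ (rowBounded_jacobiMonomial Ω u P h k),
    jacobiMonomial_zero_zero hP hΛ, rowAct_jacobiMonomial hP hΛ, entries, hP.zero, mul_one]
  simp only [hΛ.moment, pow_zero, pow_one, one_mul, mul_one, map_add, add_mul]
  rw [pow_succ' (X 0) h, pow_succ' (X 1) k, mul_assoc, mul_left_comm (X 1)]
  ring

end Action

/-! ### Differentiation of time-dependent polynomials -/

/-- `F' = dF/dt` at the time `t ≥ 0`, coefficient by coefficient (one-sided at `t = 0`). -/
def HasPolyDeriv (F : ℝ → Poly₂) (F' : Poly₂) (t : ℝ) : Prop :=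
  ∀ e, HasDerivWithinAt (fun s => coeff e (F s)) (coeff e F') (Ici 0) t

lemma hasPolyDeriv_const (p : Poly₂) (t : ℝ) : HasPolyDeriv (fun _ => p) 0 t := fun e => by
  simpa using hasDerivWithinAt_const t (Ici 0) (coeff e p)

section PolyDeriv

variable {F G : ℝ → Poly₂} {F' G' : Poly₂} {t : ℝ}

lemma HasPolyDeriv.unique (ht : 0 ≤ t) (hF : HasPolyDeriv F F' t) (hG : HasPolyDeriv F G' t) :
    F' = G' := by
  ext e
  exact (uniqueDiffOn_Ici 0 t ht).eq_deriv _ (hF e) (hG e)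

lemma HasPolyDeriv.congr (hF : HasPolyDeriv F F' t) (ht : 0 ≤ t) (h : ∀ s, 0 ≤ s → G s = F s) :
    HasPolyDeriv G F' t := fun e =>
  (hF e).congr (fun s hs => by rw [h s hs]) (by rw [h t ht])

lemma HasPolyDeriv.sub (hF : HasPolyDeriv F F' t) (hG : HasPolyDeriv G G' t) :
    HasPolyDeriv (fun s => F s - G s) (F' - G') t := fun e => by
  simpa using (hF e).fun_sub (hG e)

lemma HasPolyDeriv.mul (hF : HasPolyDeriv F F' t) (hG : HasPolyDeriv G G' t) :
    HasPolyDeriv (fun s => F s * G s) (F' * G t + F t * G') t := fun e => by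
  simp only [coeff_mul, coeff_add, ← Finset.sum_add_distrib]
  exact HasDerivWithinAt.fun_sum fun x _ => (hF x.1).mul (hG x.2)

lemma HasPolyDeriv.mul_const (hF : HasPolyDeriv F F' t) (p : Poly₂) :
    HasPolyDeriv (fun s => F s * p) (F' * p) t := by
  simpa using hF.mul (hasPolyDeriv_const p t)

lemma HasPolyDeriv.const_mul (hF : HasPolyDeriv F F' t) (p : Poly₂) :
    HasPolyDeriv (fun s => p * F s) (p * F') t := by
  simpa using (hasPolyDeriv_const p t).mul hF

lemma HasPolyDeriv.smul {f : ℝ → ℝ} {f' : ℝ} (hf : HasDerivWithinAt f f' (Ici 0) t)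
    (hF : HasPolyDeriv F F' t) : HasPolyDeriv (fun s => f s • F s) (f' • F t + f t • F') t :=
  fun e => by simpa using hf.fun_mul (hF e)

lemma HasPolyDeriv.sum {ι : Type*} {T : Finset ι} {F : ι → ℝ → Poly₂} {F' : ι → Poly₂}
    (h : ∀ j ∈ T, HasPolyDeriv (F j) (F' j) t) :
    HasPolyDeriv (fun s => ∑ j ∈ T, F j s) (∑ j ∈ T, F' j) t := fun e => by
  simp only [coeff_sum]
  exact HasDerivWithinAt.fun_sum fun j hj => h j hj e

lemma HasPolyDeriv.mem_degLT {n : ℕ} (ht : 0 ≤ t) (hF : HasPolyDeriv F F' t)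
    (h : ∀ s, 0 ≤ s → F s ∈ degLT n) : F' ∈ degLT n := by
  rw [Toda2D.mem_degLT]
  intro e he
  refine (uniqueDiffOn_Ici 0 t ht).eq_deriv _ (hF e) ?_
  exact (hasDerivWithinAt_const t (Ici 0) (0 : ℝ)).congr
    (fun s hs => Toda2D.mem_degLT.1 (h s hs) e he) (Toda2D.mem_degLT.1 (h t ht) e he)

end PolyDeriv

lemma mem_degLT_totalDegree (p : Poly₂) : p ∈ degLT (p.totalDegree + 1) :=
  mem_degLT_iff_support.2 fun e he => Nat.lt_succ_of_le (by
    rw [Finsupp.degree_eq_sum]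
    simpa [Finsupp.sum_fintype] using le_totalDegree he)

/-- The exponents of total degree `< n`. -/
def exponents (n : ℕ) : Finset (Fin 2 →₀ ℕ) := (Finsupp.finite_of_degree_lt n).toFinset

lemma mem_exponents {n : ℕ} {e : Fin 2 →₀ ℕ} : e ∈ exponents n ↔ e.degree < n := by
  simp [exponents]

lemma eq_sum_exponents {n : ℕ} {p : Poly₂} (hp : p ∈ degLT n) :
    p = ∑ e ∈ exponents n, coeff e p • monomial e 1 := by
  conv_lhs => rw [p.as_sum]
  simp only [smul_monomial, smul_eq_mul, mul_one]
  refine Finset.sum_subset (fun e he => ?_) fun e _ he => ?_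
  · exact mem_exponents.2 (mem_degLT_iff_support.1 hp e he)
  · rw [notMem_support_iff.1 he, map_zero]

/-! ### Evolution of the moments and of the orthogonal polynomials -/

/-- The evolution `Λ_t(p)˙ = -Λ_t((x + y) p) + Λ_t(p) Λ_t(x + y)` of a functional on one
polynomial `p`. -/
def MomentFlow (Λ : ℝ → Poly₂ →ₗ[ℝ] ℝ) (p : Poly₂) : Prop :=
  ∀ t, 0 ≤ t → HasDerivWithinAt (fun s => Λ s p)
    (-Λ t ((X 0 + X 1) * p) + Λ t p * Λ t (X 0 + X 1)) (Ici 0) t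

lemma MomentFlow.of_monomial {Λ : ℝ → Poly₂ →ₗ[ℝ] ℝ} {n : ℕ}
    (h : ∀ e ∈ exponents n, MomentFlow Λ (monomial e 1)) {p : Poly₂} (hp : p ∈ degLT n) :
    MomentFlow Λ p := by
  intro t ht
  have key := HasDerivWithinAt.fun_sum fun e he => (h e he t ht).const_mul (coeff e p)
  simp only [mul_add, Finset.sum_add_distrib, ← mul_assoc, ← Finset.sum_mul, mul_neg,
    Finset.sum_neg_distrib] at key
  have e1 : ∀ s, Λ s p = ∑ e ∈ exponents n, coeff e p * Λ s (monomial e 1) := by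
    intro s
    conv_lhs => rw [eq_sum_exponents hp]
    simp
  have e2 : Λ t ((X 0 + X 1) * p) =
      ∑ e ∈ exponents n, coeff e p * Λ t ((X 0 + X 1) * monomial e 1) := by
    conv_lhs => rw [eq_sum_exponents hp]
    simp only [Finset.mul_sum, mul_smul_comm, map_sum, map_smul, smul_eq_mul]
  simp only [← e1] at key
  rw [e2]
  exact key

/-- The product rule for `Λ_t(F(t))`. -/
lemma MomentFlow.apply {Λ : ℝ → Poly₂ →ₗ[ℝ] ℝ} {n : ℕ} {F : ℝ → Poly₂} {F' : Poly₂} {t : ℝ}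
    (h : ∀ p ∈ degLT n, MomentFlow Λ p) (ht : 0 ≤ t) (hF : HasPolyDeriv F F' t)
    (hd : ∀ s, 0 ≤ s → F s ∈ degLT n) :
    HasDerivWithinAt (fun s => Λ s (F s))
      (Λ t F' - Λ t ((X 0 + X 1) * F t) + Λ t (F t) * Λ t (X 0 + X 1)) (Ici 0) t := by
  have hm : ∀ e ∈ exponents n, (monomial e 1 : Poly₂) ∈ degLT n := fun e he =>
    (monomial_mem_restrictSupport ℝ).2 (Or.inl (mem_exponents.1 he))
  have key := HasDerivWithinAt.fun_sum (u := exponents n) fun e he =>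
    (hF e).mul (h _ (hm e he) t ht)
  have e1 : ∀ s, ∀ p ∈ degLT n, Λ s p = ∑ e ∈ exponents n, coeff e p * Λ s (monomial e 1) := by
    intro s p hp
    conv_lhs => rw [eq_sum_exponents hp]
    simp
  have e2 : Λ t ((X 0 + X 1) * F t) =
      ∑ e ∈ exponents n, coeff e (F t) * Λ t ((X 0 + X 1) * monomial e 1) := by
    conv_lhs => rw [eq_sum_exponents (hd t ht)]
    simp only [Finset.mul_sum, mul_smul_comm, map_sum, map_smul, smul_eq_mul]
  have e3 : Λ t F' - Λ t ((X 0 + X 1) * F t) + Λ t (F t) * Λ t (X 0 + X 1) =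
      ∑ e ∈ exponents n, (coeff e F' * Λ t (monomial e 1) + coeff e (F t) *
        (-Λ t ((X 0 + X 1) * monomial e 1) + Λ t (monomial e 1) * Λ t (X 0 + X 1))) := by
    rw [e1 t F' (hF.mem_degLT ht hd), e1 t (F t) (hd t ht), e2, Finset.sum_mul,
      ← Finset.sum_sub_distrib, ← Finset.sum_add_distrib]
    refine Finset.sum_congr rfl fun e _ => ?_
    ring
  rw [e3]
  exact key.congr (fun s hs => e1 s _ (hd s hs)) (e1 t _ (hd t ht))

lemma differentiableWithinAt_det {ι : Type*} [Fintype ι] [DecidableEq ι]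
    {M : ℝ → Matrix ι ι ℝ} {S : Set ℝ} {t : ℝ}
    (h : ∀ i j, DifferentiableWithinAt ℝ (fun s => M s i j) S t) :
    DifferentiableWithinAt ℝ (fun s => (M s).det) S t := by
  simp only [Matrix.det_apply, Units.smul_def, zsmul_eq_mul]
  exact DifferentiableWithinAt.fun_sum fun σ _ =>
    (DifferentiableWithinAt.fun_finsetProd fun i _ => h _ _).const_mul _

lemma differentiableWithinAt_inv {ι : Type*} [Fintype ι] [DecidableEq ι]
    {M : ℝ → Matrix ι ι ℝ} {S : Set ℝ} {t : ℝ}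
    (h : ∀ i j, DifferentiableWithinAt ℝ (fun s => M s i j) S t) (h0 : (M t).det ≠ 0) (i j : ι) :
    DifferentiableWithinAt ℝ (fun s => (M s)⁻¹ i j) S t := by
  simp only [Matrix.inv_def, Ring.inverse_eq_inv', Matrix.smul_apply, smul_eq_mul,
    Matrix.adjugate_apply]
  refine ((differentiableWithinAt_det h).inv h0).mul (differentiableWithinAt_det fun k l => ?_)
  simp only [Matrix.updateRow_apply]
  split_ifs
  · exact differentiableWithinAt_const _
  · exact h k l

section Evolution

variable {Ω : Set (Fin 2 → ℝ)} {w : ℝ → (Fin 2 → ℝ) → ℝ} {P : ℝ → PolySeq}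
  {Λ : ℝ → Poly₂ →ₗ[ℝ] ℝ}

/-- The Gram matrix of the monomials of degree `< n` is invertible. -/
lemma det_monomial_gram_ne_zero {u : (Fin 2 → ℝ) → ℝ} {L : Poly₂ →ₗ[ℝ] ℝ} (hL : IsIntegral Ω u L)
    (n : ℕ) : (Matrix.of fun e f : exponents n =>
      L (monomial (e : Fin 2 →₀ ℕ) 1 * monomial (f : Fin 2 →₀ ℕ) 1)).det ≠ 0 := by
  intro h0
  obtain ⟨v, hv, h⟩ := Matrix.exists_mulVec_eq_zero_iff.2 h0
  set p : Poly₂ := ∑ e : exponents n, v e • monomial (e : Fin 2 →₀ ℕ) 1 with hp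
  have hpp : L (p * p) = 0 := by
    have h1 : ∀ e : exponents n, L (monomial (e : Fin 2 →₀ ℕ) 1 * p) = 0 := by
      intro e
      have := congrFun h e
      simp only [Matrix.mulVec, dotProduct, Matrix.of_apply, Pi.zero_apply] at this
      rw [← this, hp, Finset.mul_sum, map_sum]
      refine Finset.sum_congr rfl fun f _ => ?_
      rw [mul_smul_comm, map_smul, smul_eq_mul, mul_comm]
    conv_lhs => rw [hp, Finset.sum_mul, map_sum, ← hp]
    refine Finset.sum_eq_zero fun e _ => ?_
    rw [smul_mul_assoc, map_smul, h1, smul_zero]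
  have hp0 := hL.eq_zero hpp
  refine hv (funext fun e => ?_)
  have := congrArg (coeff (e : Fin 2 →₀ ℕ)) hp0
  simp only [hp, coeff_sum, coeff_smul, coeff_monomial, smul_eq_mul, mul_ite, mul_one, mul_zero,
    coeff_zero, Subtype.coe_inj, Finset.sum_ite_eq', Finset.mem_univ, if_true] at this
  exact this

/-- If all moments are differentiable in time, so are the coefficients of the monic orthogonal
polynomials, since these solve a linear system whose coefficients are moments. -/
lemma exists_hasPolyDeriv (hP : ∀ t, 0 ≤ t → IsMonicOPS Ω (w t) (P t))
    (hΛ : ∀ t, 0 ≤ t → IsIntegral Ω (w t) (Λ t)) (hflow : ∀ p, MomentFlow Λ p) {t : ℝ}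
    (ht : 0 ≤ t) (n : ℕ) (a : Fin (n + 1)) : ∃ F' ∈ degLT n,
      HasPolyDeriv (fun s => P s n a) F' t := by
  set x : Poly₂ := X 0 ^ (n - (a : ℕ)) * X 1 ^ (a : ℕ) with hx
  set G : ℝ → Matrix (exponents n) (exponents n) ℝ := fun s => Matrix.of fun e f =>
    Λ s (monomial (e : Fin 2 →₀ ℕ) 1 * monomial (f : Fin 2 →₀ ℕ) 1) with hG
  have hsub : ∀ s, 0 ≤ s → P s n a - x ∈ degLT n := fun s hs => (hP s hs).sub_mem n a
  clear_value x
  have hdet : ∀ s, 0 ≤ s → (G s).det ≠ 0 := fun s hs => det_monomial_gram_ne_zero (hΛ s hs) n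
  -- The lower order coefficients of `ℙ_n`, as a row vector, are `-b G⁻¹` for the moments `b` of the
  -- leading monomial `x`.
  have hsolve : ∀ s, 0 ≤ s → ∀ e : exponents n, coeff (e : Fin 2 →₀ ℕ) (P s n a - x) =
      ∑ f : exponents n, -Λ s (x * monomial (f : Fin 2 →₀ ℕ) 1) * (G s)⁻¹ f e := by
    intro s hs
    have h1 : Matrix.vecMul (fun e : exponents n => coeff (e : Fin 2 →₀ ℕ) (P s n a - x)) (G s) =
        fun f : exponents n => -Λ s (x * monomial (f : Fin 2 →₀ ℕ) 1) := by
      ext f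
      have hf : (monomial (f : Fin 2 →₀ ℕ) 1 : Poly₂) ∈ degLT n :=
        (monomial_mem_restrictSupport ℝ).2 (Or.inl (mem_exponents.1 f.2))
      have h2 := (hP s hs).orth (hΛ s hs) a hf
      have h3 : P s n a * monomial (f : Fin 2 →₀ ℕ) 1 =
          (P s n a - x) * monomial (f : Fin 2 →₀ ℕ) 1 + x * monomial (f : Fin 2 →₀ ℕ) 1 := by ring
      rw [h3, map_add] at h2
      rw [← eq_neg_of_add_eq_zero_left h2]
      conv_rhs => rw [eq_sum_exponents (hsub s hs), ← Finset.sum_coe_sort]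
      simp only [Matrix.vecMul, dotProduct, hG, Matrix.of_apply, Finset.sum_mul, map_sum,
        smul_mul_assoc, map_smul, smul_eq_mul]
    intro e
    have h2 := congrArg (fun v => Matrix.vecMul v (G s)⁻¹) h1
    simp only [Matrix.vecMul_vecMul] at h2
    rw [Matrix.mul_nonsing_inv _ (hdet s hs).isUnit, Matrix.vecMul_one] at h2
    exact congrFun h2 e
  have hdiff : ∀ e : exponents n, DifferentiableWithinAt ℝ
      (fun s => coeff (e : Fin 2 →₀ ℕ) (P s n a - x)) (Ici 0) t := by
    intro e
    have hΛd : ∀ p, DifferentiableWithinAt ℝ (fun s => Λ s p) (Ici 0) t := fun p =>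
      (hflow p t ht).differentiableWithinAt
    have h1 : DifferentiableWithinAt ℝ
        (fun s => ∑ f : exponents n, -Λ s (x * monomial (f : Fin 2 →₀ ℕ) 1) * (G s)⁻¹ f e)
        (Ici 0) t :=
      DifferentiableWithinAt.fun_sum fun f _ => (hΛd _).fun_neg.mul
        (differentiableWithinAt_inv (fun _ _ => hΛd _) (hdet t ht) f e)
    exact h1.congr (fun s hs => hsolve s hs e) (hsolve t ht e)
  refine ⟨∑ e ∈ exponents n,
    derivWithin (fun s => coeff e (P s n a - x)) (Ici 0) t • monomial e 1, ?_, fun e => ?_⟩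
  · exact Submodule.sum_mem _ fun e he => Submodule.smul_mem _ _
      ((monomial_mem_restrictSupport ℝ).2 (Or.inl (mem_exponents.1 he)))
  · have hc : coeff e (∑ e ∈ exponents n,
        derivWithin (fun s => coeff e (P s n a - x)) (Ici 0) t • monomial e 1) =
        derivWithin (fun s => coeff e (P s n a - x)) (Ici 0) t := by
      simp only [coeff_sum, coeff_smul, coeff_monomial, smul_eq_mul, mul_ite, mul_one, mul_zero,
        Finset.sum_ite_eq']
      split_ifs with he
      · rfl
      · rw [mem_exponents, not_lt] at he
        rw [derivWithin_congr (f := fun _ => (0 : ℝ)) (s := Ici (0 : ℝ))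
          (fun s hs => mem_degLT.1 (hsub s hs) e he)
          (mem_degLT.1 (hsub t ht) e he)]
        simp
    rw [hc]
    have hd : DifferentiableWithinAt ℝ (fun s => coeff e (P s n a - x)) (Ici 0) t := by
      by_cases he : e ∈ exponents n
      · exact hdiff ⟨e, he⟩
      · rw [mem_exponents, not_lt] at he
        exact (differentiableWithinAt_const (0 : ℝ)).congr
          (fun s hs => mem_degLT.1 (hsub s hs) e he)
          (mem_degLT.1 (hsub t ht) e he)
    have := hd.hasDerivWithinAt.add_const (coeff e x)
    simpa only [coeff_sub, sub_add_cancel] using this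

/-- The evolution `ℙ̇ = A ℙ` of the monic orthogonal system; its block `n` is
`ℙ̇_n = C_n ℙ_(n-1)`, and `ℙ̇_0 = 0`. -/
def PolyFlow (Ω : Set (Fin 2 → ℝ)) (w : ℝ → (Fin 2 → ℝ) → ℝ) (P : ℝ → PolySeq) : Prop :=
  ∀ t, 0 ≤ t → ∀ r, HasPolyDeriv (fun s => entries (P s) r)
    (rowAct (matA Ω (w t) (P t)) (entries (P t)) r) t

lemma polyFlow_iff (hP : ∀ t, 0 ≤ t → IsMonicOPS Ω (w t) (P t)) : PolyFlow Ω w P ↔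
    ∀ t, 0 ≤ t → ∀ (n : ℕ) (m : Fin (n + 2)) (e : Fin 2 →₀ ℕ),
      HasDerivWithinAt (fun s => (P s (n + 1) m).coeff e)
        ((∑ j, MvPolynomial.C (sumC Ω (w t) (P t) n m j) * P t n j).coeff e) (Ici 0) t := by
  constructor
  · intro h t ht n m e
    have := h t ht ⟨n + 1, m⟩ e
    rw [rowAct_matA_succ] at this
    simpa only [C_mul', entries] using this
  · rintro h t ht ⟨n, m⟩ e
    cases n with
    | zero =>
      rw [rowAct_matA_zero]
      exact (hasPolyDeriv_const 1 t).congr ht (fun s hs => (hP s hs).zero m) e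
    | succ n =>
      rw [rowAct_matA_succ]
      simpa only [C_mul', entries] using h t ht n m e

/-- The moment equations imply the evolution of the orthogonal polynomials: differentiate
`Λ_t(ℙ_n p) = 0` for `p` of degree `< n`. -/
lemma polyFlow_of_momentFlow (hP : ∀ t, 0 ≤ t → IsMonicOPS Ω (w t) (P t))
    (hΛ : ∀ t, 0 ≤ t → IsIntegral Ω (w t) (Λ t)) (hflow : ∀ p, MomentFlow Λ p) :
    PolyFlow Ω w P := by
  rw [polyFlow_iff hP]
  intro t ht n a
  obtain ⟨F', hF', hF⟩ := exists_hasPolyDeriv hP hΛ hflow ht (n + 1) a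
  suffices h : F' = ∑ j, C (sumC Ω (w t) (P t) n a j) * P t n j by rwa [← h]
  rw [← sub_eq_zero]
  refine (hP t ht).eq_zero_of_orth (hΛ t ht) (n := n + 1) (Submodule.sub_mem _ hF'
    (Submodule.sum_mem _ fun c _ => ?_)) fun k hk b => ?_
  · rw [C_mul']
    exact Submodule.smul_mem _ _ ((hP t ht).mem n c)
  · have hp : P t k b ∈ degLT (n + 1) := degLT_mono (by omega) ((hP t ht).mem k b)
    have h1 := MomentFlow.apply (Λ := Λ) (n := n + 1 + (n + 1)) (fun p _ => hflow p) ht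
      (hF.mul_const (P t k b)) fun s hs => mul_mem_degLT ((hP s hs).mem (n + 1) a) hp
    have h2 : HasDerivWithinAt (fun s => Λ s (P s (n + 1) a * P t k b)) 0 (Ici 0) t :=
      (hasDerivWithinAt_const t (Ici 0) (0 : ℝ)).congr
        (fun s hs => (hP s hs).orth (hΛ s hs) a hp) ((hP t ht).orth (hΛ t ht) a hp)
    have h3 := (uniqueDiffOn_Ici 0 t ht).eq_deriv _ h1 h2
    rw [(hP t ht).orth (hΛ t ht) a hp, zero_mul, add_zero] at h3
    rw [sub_mul, map_sub, inner_sumC (hP t ht) (hΛ t ht) n a hp, ← h3, mul_assoc]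

/-- The evolution of the orthogonal polynomials implies the moment equations, by induction on the
degree: a monomial is an entry of `ℙ_n`, whose integral vanishes, plus a polynomial of lower
degree. -/
lemma momentFlow_of_polyFlow (hP : ∀ t, 0 ≤ t → IsMonicOPS Ω (w t) (P t))
    (hΛ : ∀ t, 0 ≤ t → IsIntegral Ω (w t) (Λ t)) (h : PolyFlow Ω w P) (p : Poly₂) :
    MomentFlow Λ p := by
  have key : ∀ n, ∀ p ∈ degLT n, MomentFlow Λ p := by
    intro n
    induction n with
    | zero =>
      intro p hp t _
      simpa [eq_zero_of_mem_degLT_zero hp] using hasDerivWithinAt_const t (Ici 0) (0 : ℝ)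
    | succ n ih =>
      intro p hp
      refine MomentFlow.of_monomial (fun e he => ?_) hp
      rw [mem_exponents] at he
      rcases Nat.lt_succ_iff_lt_or_eq.1 he with hlt | heq
      · exact ih _ ((monomial_mem_restrictSupport ℝ).2 (Or.inl hlt))
      intro t ht
      rcases n.eq_zero_or_pos with rfl | hn
      · obtain rfl : e = 0 := (Finsupp.degree_eq_zero_iff e).1 heq
        have h1 : (monomial (0 : Fin 2 →₀ ℕ) 1 : Poly₂) = 1 := rfl
        rw [h1, mul_one, (hΛ t ht).one, one_mul, neg_add_cancel]
        exact (hasDerivWithinAt_const t (Ici 0) (1 : ℝ)).congr (fun s hs => (hΛ s hs).one)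
          (hΛ t ht).one
      · obtain ⟨n, rfl⟩ : ∃ k, n = k + 1 := ⟨n - 1, by omega⟩
        have hdeg := degree_eq e
        set a : Fin (n + 2) := ⟨e 1, by omega⟩ with ha
        have hx : (X 0 ^ (n + 1 - (a : ℕ)) * X 1 ^ (a : ℕ) : Poly₂) = monomial e 1 := by
          have h4 : n + 1 - e 1 = e 0 := by omega
          rw [monomial_eq_X_pow, ha, h4]
        have hQ : ∀ s, 0 ≤ s → P s (n + 1) a - monomial e 1 ∈ degLT (n + 1) := by
          intro s hs
          have := (hP s hs).sub_mem (n + 1) a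
          rwa [hx] at this
        have hzero : ∀ s, 0 ≤ s → Λ s (P s (n + 1) a) = 0 := by
          intro s hs
          have h1 : (1 : Poly₂) ∈ degLT (n + 1) := degLT_mono (by omega) (C_mem_degLT 1)
          have := (hP s hs).orth (hΛ s hs) a h1
          rwa [mul_one] at this
        have hPd := h t ht ⟨n + 1, a⟩
        rw [rowAct_matA_succ] at hPd
        have h1 := (MomentFlow.apply ih ht (hPd.sub (hasPolyDeriv_const (monomial e 1) t)) hQ).neg
        have hone := inner_sumC (hP t ht) (hΛ t ht) n a
          (degLT_mono (by omega) (C_mem_degLT 1) : C 1 ∈ degLT (n + 1))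
        simp only [map_one, mul_one, C_mul'] at hone
        have hval : -(Λ t ((∑ c, sumC Ω (w t) (P t) n a c • entries (P t) ⟨n, c⟩) - 0) -
            Λ t ((X 0 + X 1) * (entries (P t) ⟨n + 1, a⟩ - monomial e 1)) +
            Λ t (entries (P t) ⟨n + 1, a⟩ - monomial e 1) * Λ t (X 0 + X 1)) =
            -Λ t ((X 0 + X 1) * monomial e 1) + Λ t (monomial e 1) * Λ t (X 0 + X 1) := by
          simp only [entries, sub_zero, mul_sub, map_sub, hone, hzero t ht]
          ring
        rw [hval] at h1
        refine h1.congr (fun s hs => ?_) ?_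
        · simp [entries, hzero s hs]
        · simp [entries, hzero t ht]
  exact key (p.totalDegree + 1) p (mem_degLT_totalDegree p)

/-! ### The Lax pairs and the lattice equations -/

/-- The Lax equations `J̇_i = [A, J_i]`. -/
def LaxFlow (Ω : Set (Fin 2 → ℝ)) (w : ℝ → (Fin 2 → ℝ) → ℝ) (P : ℝ → PolySeq) : Prop :=
  ∀ t, 0 ≤ t → ∀ i : Fin 2, HasEntryDeriv (fun s => jacobi Ω (w s) (P s) i)
    (infComm (matA Ω (w t) (P t)) (jacobi Ω (w t) (P t) i)) t

/-- The entries of the Jacobi matrices are differentiable, being rational functions of moments and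
of the coefficients of the orthogonal polynomials. -/
lemma exists_hasEntryDeriv_jacobi (hP : ∀ t, 0 ≤ t → IsMonicOPS Ω (w t) (P t))
    (hΛ : ∀ t, 0 ≤ t → IsIntegral Ω (w t) (Λ t)) (hflow : ∀ p, MomentFlow Λ p)
    (h : PolyFlow Ω w P) {t : ℝ} (ht : 0 ≤ t) (i : Fin 2) : ∃ J' : BlockMat, RowBounded 1 J' ∧
      HasEntryDeriv (fun s => jacobi Ω (w s) (P s) i) J' t := by
  have hinner : ∀ (q : Poly₂) (n m : ℕ) (a : Fin (n + 1)) (b : Fin (m + 1)),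
      DifferentiableWithinAt ℝ (fun s => polyInner Ω (w s) (q * P s n a) (P s m b)) (Ici 0) t := by
    intro q n m a b
    have h1 := MomentFlow.apply (n := q.totalDegree + n + (m + 1)) (fun p _ => hflow p) ht
      (((h t ht ⟨n, a⟩).const_mul q).mul (h t ht ⟨m, b⟩)) fun s hs =>
        mul_mem_degLT (show q * P s n a ∈ degLT (q.totalDegree + n + 1) from
          mul_mem_degLT (n := n + 1) (mem_degLT_totalDegree q) ((hP s hs).mem n a))
          ((hP s hs).mem m b)
    exact h1.differentiableWithinAt.congr (fun s hs => (hΛ s hs).inner _ _) ((hΛ t ht).inner _ _)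
  have hgram : ∀ n a b, DifferentiableWithinAt ℝ (fun s => gram Ω (w s) (P s) n a b) (Ici 0) t := by
    intro n a b
    simpa [gram] using hinner 1 n n a b
  have hginv : ∀ n a b,
      DifferentiableWithinAt ℝ (fun s => (gram Ω (w s) (P s) n)⁻¹ a b) (Ici 0) t := fun n a b =>
    differentiableWithinAt_inv (hgram n) ((hP t ht).isUnit_det n).ne_zero a b
  have hJ : ∀ r c, DifferentiableWithinAt ℝ (fun s => jacobi Ω (w s) (P s) i r c) (Ici 0) t := by
    rintro ⟨n, a⟩ ⟨m, b⟩
    by_cases hz : n + 1 < m ∨ m + 1 < n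
    · have h0 : ∀ s, jacobi Ω (w s) (P s) i ⟨n, a⟩ ⟨m, b⟩ = 0 := fun s =>
        jacobi_eq_zero Ω (w s) (P s) i hz
      simp only [h0]
      exact differentiableWithinAt_const _
    obtain rfl | rfl | rfl : n = m ∨ n = m + 1 ∨ m = n + 1 := by omega
    · simp only [jacobi_diag, coefD, Matrix.mul_apply, Matrix.of_apply]
      exact DifferentiableWithinAt.fun_sum fun c _ => (hinner _ _ _ _ _).mul (hginv _ _ _)
    · have h1 : ∀ s, jacobi Ω (w s) (P s) i ⟨m + 1, a⟩ ⟨m, b⟩ = ∑ c,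
          gram Ω (w s) (P s) (m + 1) a (shiftIdx i c) * (gram Ω (w s) (P s) m)⁻¹ c b := by
        intro s
        rw [jacobi_lower, coefC, Matrix.mul_apply]
        simp only [mul_transpose_shiftL]
      simp only [h1]
      exact DifferentiableWithinAt.fun_sum fun c _ => (hgram _ _ _).mul (hginv _ _ _)
    · simp only [jacobi_upper]
      exact differentiableWithinAt_const _
  refine ⟨fun r c => derivWithin (fun s => jacobi Ω (w s) (P s) i r c) (Ici 0) t,
    fun r c hrc => ?_, fun r c => (hJ r c).hasDerivWithinAt⟩
  have h0 : ∀ s, jacobi Ω (w s) (P s) i r c = 0 := fun s =>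
    jacobi_eq_zero Ω (w s) (P s) i (Or.inl hrc)
  simp [h0]

/-- Differentiating `J_i ℙ = x_i ℙ` along `ℙ̇ = A ℙ` gives `(J̇_i - [A, J_i]) ℙ = 0`. -/
lemma laxFlow_of_polyFlow (hP : ∀ t, 0 ≤ t → IsMonicOPS Ω (w t) (P t))
    (hΛ : ∀ t, 0 ≤ t → IsIntegral Ω (w t) (Λ t)) (h : PolyFlow Ω w P) : LaxFlow Ω w P := by
  intro t ht i
  obtain ⟨J', hb', hJ'⟩ := exists_hasEntryDeriv_jacobi hP hΛ
    (momentFlow_of_polyFlow hP hΛ h) h ht i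
  set A := matA Ω (w t) (P t) with hA
  set J := jacobi Ω (w t) (P t) i with hJ
  have hbJ : RowBounded 1 J := rowBounded_jacobi _ _ _ _
  have hbA : RowBounded 0 A := rowBounded_matA _ _ _
  have hbc : RowBounded 1 (infComm A J) := (hbA.infComm hbJ).mono (by omega)
  suffices hEq : J' = infComm A J by rwa [← hEq]
  ext r c
  refine sub_eq_zero.1 (eq_zero_of_rowAct (hP t ht) (hΛ t ht) (hb'.sub hbc) ?_ c)
  have h1 : HasPolyDeriv (fun s => rowAct (jacobi Ω (w s) (P s) i) (entries (P s)) r)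
      (rowAct J' (entries (P t)) r + rowAct J (rowAct A (entries (P t))) r) t := by
    have key := HasPolyDeriv.sum (T := upTo (r.1 + 1 + 1))
      fun s (_ : s ∈ upTo (r.1 + 1 + 1)) => HasPolyDeriv.smul (hJ' r s) (h t ht s)
    rw [Finset.sum_add_distrib, ← rowAct_eq_sum hb' _ (Nat.lt_succ_self _),
      ← rowAct_eq_sum hbJ _ (Nat.lt_succ_self _)] at key
    exact key.congr ht fun s _ => rowAct_eq_sum (rowBounded_jacobi _ _ _ _) _ (Nat.lt_succ_self _)
  have h2 : HasPolyDeriv (fun s => rowAct (jacobi Ω (w s) (P s) i) (entries (P s)) r)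
      (X i * rowAct A (entries (P t)) r) t :=
    ((h t ht r).const_mul (X i)).congr ht fun s hs => rowAct_jacobi (hP s hs) (hΛ s hs) i r
  have h3 := h1.unique ht h2
  have hb1 : RowBounded 1 (infMul A J) := (hbA.infMul hbJ).mono (by omega)
  rw [sub_rowAct hb' hbc, infComm, sub_rowAct hb1 (hbJ.infMul hbA),
    rowAct_infMul hbA hbJ, rowAct_infMul hbJ hbA,
    funext (rowAct_jacobi (hP t ht) (hΛ t ht) i), rowAct_mul_left hbA, ← h3]
  abel

/-- The Lax equation for the products of powers. -/
lemma LaxFlow.jacobiMonomial (h : LaxFlow Ω w P) {t : ℝ} (ht : 0 ≤ t) (m k : ℕ) :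
    HasEntryDeriv (fun s => jacobiMonomial Ω (w s) (P s) m k)
      (infComm (matA Ω (w t) (P t)) (Toda2D.jacobiMonomial Ω (w t) (P t) m k)) t :=
  HasEntryDeriv.lax_infMul ht (rowBounded_matA _ _ _)
    ((h t ht 0).lax_infPow ht (rowBounded_matA _ _ _) (fun _ _ => rowBounded_jacobi _ _ _ _) m)
    ((h t ht 1).lax_infPow ht (rowBounded_matA _ _ _) (fun _ _ => rowBounded_jacobi _ _ _ _) k)
    (fun _ _ => (rowBounded_jacobi _ _ _ _).infPow m)
    (fun _ _ => (rowBounded_jacobi _ _ _ _).infPow k)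

lemma LaxFlow.lattice (h : LaxFlow Ω w P) {t : ℝ} (ht : 0 ≤ t) (i : Fin 2) (n : ℕ) :
    HasEntryDeriv (fun s => coefD Ω (w s) (P s) i (n + 1))
      (sumC Ω (w t) (P t) n * shiftL i n - shiftL i (n + 1) * sumC Ω (w t) (P t) (n + 1)) t ∧
    HasEntryDeriv (fun s => coefC Ω (w s) (P s) i n)
      (sumC Ω (w t) (P t) n * coefD Ω (w t) (P t) i n
        - coefD Ω (w t) (P t) i (n + 1) * sumC Ω (w t) (P t) n) t := by
  constructor
  · intro a b
    simpa only [jacobi_diag, infComm_diag] using h t ht i ⟨n + 1, a⟩ ⟨n + 1, b⟩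
  · intro a b
    simpa only [jacobi_lower, infComm_lower] using h t ht i ⟨n + 1, a⟩ ⟨n, b⟩

/-- The lattice equations imply the Lax equations. The equation for `D_0` is not among the lattice
equations; it follows from those for `D_1`, as `D_(0,i)` is a difference of entries of the
matrices `D_(1,j)`. -/
lemma laxFlow_of_lattice (hP : ∀ t, 0 ≤ t → IsMonicOPS Ω (w t) (P t))
    (hΛ : ∀ t, 0 ≤ t → IsIntegral Ω (w t) (Λ t))
    (h : ∀ t, 0 ≤ t → ∀ (i : Fin 2) (n : ℕ),
      HasEntryDeriv (fun s => coefD Ω (w s) (P s) i (n + 1))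
        (sumC Ω (w t) (P t) n * shiftL i n - shiftL i (n + 1) * sumC Ω (w t) (P t) (n + 1)) t ∧
      HasEntryDeriv (fun s => coefC Ω (w s) (P s) i n)
        (sumC Ω (w t) (P t) n * coefD Ω (w t) (P t) i n
          - coefD Ω (w t) (P t) i (n + 1) * sumC Ω (w t) (P t) n) t) : LaxFlow Ω w P := by
  intro t ht i
  have hsh : ∀ (j : Fin 2) (a b : Fin 2),
      (sumC Ω (w t) (P t) 0 * shiftL j 0 - shiftL j 1 * sumC Ω (w t) (P t) 1) a b =
        (if b = j then sumC Ω (w t) (P t) 0 a 0 else 0) -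
          sumC Ω (w t) (P t) 1 (shiftIdx j a) b := by
    intro j a b
    rw [Matrix.sub_apply, shiftL_mul, Matrix.mul_apply, Fin.sum_univ_succ, Fin.sum_univ_zero]
    simp [shiftL, Fin.ext_iff]
  have hD0 : HasDerivWithinAt (fun s => coefD Ω (w s) (P s) i 0 0 0)
      (-sumC Ω (w t) (P t) 0 i 0) (Ici 0) t := by
    have hc : shiftIdx 0 (1 : Fin 2) = shiftIdx 1 (0 : Fin 2) := by ext; simp [shiftIdx]
    fin_cases i
    · have hd := ((h t ht 0 0).1 1 1).sub ((h t ht 1 0).1 0 1)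
      rw [hsh, hsh, hc] at hd
      have hf : ∀ s, 0 ≤ s → coefD Ω (w s) (P s) 0 0 0 0 =
          coefD Ω (w s) (P s) 0 1 1 1 - coefD Ω (w s) (P s) 1 1 0 1 := by
        intro s hs
        have := coefD_one_compat (hP s hs) (hΛ s hs) 1
        simp at this
        linarith
      refine (hd.congr hf (hf t ht)).congr_deriv ?_
      change _ = -sumC Ω (w t) (P t) 0 0 0
      rw [if_neg one_ne_zero, if_pos rfl]
      ring
    · have hd := ((h t ht 1 0).1 0 0).sub ((h t ht 0 0).1 1 0)
      rw [hsh, hsh, hc] at hd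
      have hf : ∀ s, 0 ≤ s → coefD Ω (w s) (P s) 1 0 0 0 =
          coefD Ω (w s) (P s) 1 1 0 0 - coefD Ω (w s) (P s) 0 1 1 0 := by
        intro s hs
        have := coefD_one_compat (hP s hs) (hΛ s hs) 0
        simp at this
        linarith
      refine (hd.congr hf (hf t ht)).congr_deriv ?_
      change _ = -sumC Ω (w t) (P t) 0 1 0
      rw [if_neg zero_ne_one, if_pos rfl]
      ring
  rintro ⟨n, a⟩ ⟨m, b⟩
  by_cases hz : n + 1 < m ∨ m + 1 < n
  · rw [infComm_eq_zero _ _ _ _ (hP t ht) (by simp only; omega)]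
    have h0 : ∀ s, jacobi Ω (w s) (P s) i ⟨n, a⟩ ⟨m, b⟩ = 0 := fun s =>
      jacobi_eq_zero Ω (w s) (P s) i hz
    simp only [h0]
    exact hasDerivWithinAt_const _ _ _
  obtain rfl | rfl | rfl : n = m ∨ n = m + 1 ∨ m = n + 1 := by omega
  · cases n with
    | zero =>
      rw [infComm_zero_zero]
      simp only [jacobi_diag]
      obtain rfl : a = 0 := Subsingleton.elim (α := Fin 1) _ _
      obtain rfl : b = 0 := Subsingleton.elim (α := Fin 1) _ _
      have h1 : shiftIdx i (0 : Fin 1) = i := by ext; simp [shiftIdx]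
      rw [h1]
      exact hD0
    | succ n =>
      rw [infComm_diag]
      simp only [jacobi_diag]
      exact (h t ht i n).1 a b
  · rw [infComm_lower]
    simp only [jacobi_lower]
    exact (h t ht i m).2 a b
  · rw [infComm_eq_zero _ _ _ _ (hP t ht) (Or.inl (Nat.lt_succ_self n))]
    simp only [jacobi_upper]
    exact hasDerivWithinAt_const _ _ _

end Evolution

/-! ### Integration against the weight -/

section Integration

variable {Ω : Set (Fin 2 → ℝ)} {w : ℝ → (Fin 2 → ℝ) → ℝ} {E : Type*} [NormedAddCommGroup E]
  [NormedSpace ℝ E]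

lemma exists_abs_coord_le (hΩ : IsCompact Ω) : ∃ R : ℝ, 0 ≤ R ∧ ∀ z ∈ Ω, ∀ i, |z i| ≤ R := by
  obtain ⟨R, hR⟩ := hΩ.exists_bound_of_continuousOn (f := fun z : Fin 2 → ℝ => z)
    continuousOn_id
  refine ⟨max R 0, le_max_right _ _, fun z hz i => ?_⟩
  exact (norm_le_pi_norm z i).trans ((hR z hz).trans (le_max_left _ _))

lemma integrableOn_smul {u : (Fin 2 → ℝ) → ℝ} {f : (Fin 2 → ℝ) → E} (hΩ : IsCompact Ω)
    (hu : IntegrableOn u Ω) (hf : ContinuousOn f Ω) : IntegrableOn (fun z => u z • f z) Ω :=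
  hu.smul_continuousOn hf hΩ

lemma integrableOn_mul {u : (Fin 2 → ℝ) → ℝ} {f : (Fin 2 → ℝ) → ℝ} (hΩ : IsCompact Ω)
    (hu : IntegrableOn u Ω) (hf : ContinuousOn f Ω) : IntegrableOn (fun z => f z * u z) Ω :=
  hu.continuousOn_mul hf hΩ

lemma IsTimeWeight.nonempty (hw : IsTimeWeight Ω w) : Ω.Nonempty := by
  rw [Set.nonempty_iff_ne_empty]
  rintro rfl
  simpa using hw.normalized 0 le_rfl

lemma IsTimeWeight.norm_integral_le (hΩ : IsCompact Ω) (hw : IsTimeWeight Ω w) {t : ℝ}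
    (ht : 0 ≤ t) {f : (Fin 2 → ℝ) → E} {C : ℝ} (h : ∀ z ∈ Ω, ‖f z‖ ≤ C) :
    ‖∫ z in Ω, w t z • f z‖ ≤ C := by
  have h1 : ∫ z in Ω, C * w t z = C := by
    rw [integral_const_mul, hw.normalized t ht, mul_one]
  refine (norm_integral_le_of_norm_le ((hw.integrable t ht).const_mul C) ?_).trans h1.le
  filter_upwards [ae_restrict_mem hΩ.measurableSet] with z hz
  rw [norm_smul, Real.norm_of_nonneg (hw.nonneg t ht z hz), mul_comm]
  exact mul_le_mul_of_nonneg_right (h z hz) (hw.nonneg t ht z hz)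

/-- The integration functional `p ↦ ∫ p u` as a linear map. -/
def integralFunctional (hΩ : IsCompact Ω) {u : (Fin 2 → ℝ) → ℝ} (hu : IntegrableOn u Ω) :
    Poly₂ →ₗ[ℝ] ℝ where
  toFun p := ∫ z in Ω, eval z p * u z
  map_add' p q := by
    simp only [map_add, add_mul]
    exact integral_add (integrableOn_mul hΩ hu (continuous_eval p).continuousOn)
      (integrableOn_mul hΩ hu (continuous_eval q).continuousOn)
  map_smul' c p := by
    simp only [smul_eval, mul_assoc, integral_const_mul, RingHom.id_apply, smul_eq_mul]

lemma IsTimeWeight.exists_functional (hΩ : IsCompact Ω) (hw : IsTimeWeight Ω w) :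
    ∃ Λ : ℝ → Poly₂ →ₗ[ℝ] ℝ, ∀ t, 0 ≤ t → IsIntegral Ω (w t) (Λ t) := by
  have h : ∀ t, ∃ L : Poly₂ →ₗ[ℝ] ℝ, 0 ≤ t → IsIntegral Ω (w t) L := by
    intro t
    by_cases ht : 0 ≤ t
    · refine ⟨integralFunctional hΩ (hw.integrable t ht), fun _ => ⟨fun p => rfl, ?_, ?_⟩⟩
      · simpa [integralFunctional] using hw.normalized t ht
      · intro p hp
        simpa [integralFunctional] using hw.posDef t ht p hp
    · exact ⟨0, fun h => absurd h ht⟩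
  choose Λ hΛ using h
  exact ⟨Λ, hΛ⟩

/-! ### The evolution of the integrals of a function -/

/-- The weak form of `ẇ = (D - x - y) w`, tested against the function `f`. -/
def WeightFlow (Ω : Set (Fin 2 → ℝ)) (w : ℝ → (Fin 2 → ℝ) → ℝ) (D : ℝ → ℝ)
    (f : (Fin 2 → ℝ) → E) : Prop :=
  ∀ t, 0 ≤ t → HasDerivWithinAt (fun s => ∫ z in Ω, w s z • f z)
    (∫ z in Ω, ((D t - (z 0 + z 1)) * w t z) • f z) (Ici 0) t

lemma IsTimeWeight.integrableOn_rate (hΩ : IsCompact Ω) (hw : IsTimeWeight Ω w) {t : ℝ}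
    (ht : 0 ≤ t) (c : ℝ) : IntegrableOn (fun z => (c - (z 0 + z 1)) * w t z) Ω :=
  integrableOn_mul hΩ (hw.integrable t ht) (Continuous.continuousOn (by fun_prop))

variable {D : ℝ → ℝ}

lemma WeightFlow.congr {f g : (Fin 2 → ℝ) → E} (hΩ : IsCompact Ω) (hf : WeightFlow Ω w D f)
    (h : ∀ z ∈ Ω, g z = f z) : WeightFlow Ω w D g := by
  intro t ht
  have e : ∀ u : (Fin 2 → ℝ) → ℝ, ∫ z in Ω, u z • g z = ∫ z in Ω, u z • f z := fun u =>
    setIntegral_congr_fun hΩ.measurableSet fun z hz => by simp only [h z hz]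
  simp only [e]
  exact hf t ht

lemma WeightFlow.sub {f g : (Fin 2 → ℝ) → E} (hΩ : IsCompact Ω) (hw : IsTimeWeight Ω w)
    (hfc : ContinuousOn f Ω) (hgc : ContinuousOn g Ω) (hf : WeightFlow Ω w D f)
    (hg : WeightFlow Ω w D g) : WeightFlow Ω w D (fun z => f z - g z) := by
  intro t ht
  have e : ∀ u : (Fin 2 → ℝ) → ℝ, IntegrableOn u Ω → ∫ z in Ω, u z • (f z - g z) =
      (∫ z in Ω, u z • f z) - ∫ z in Ω, u z • g z := by
    intro u hu
    simp only [smul_sub]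
    exact integral_sub (integrableOn_smul hΩ hu hfc) (integrableOn_smul hΩ hu hgc)
  rw [e _ (hw.integrableOn_rate hΩ ht (D t))]
  exact ((hf t ht).sub (hg t ht)).congr (fun s hs => e _ (hw.integrable s hs))
    (e _ (hw.integrable t ht))

lemma WeightFlow.const_mul {f : (Fin 2 → ℝ) → ℝ} (c : ℝ) (hf : WeightFlow Ω w D f) :
    WeightFlow Ω w D (fun z => c * f z) := by
  intro t ht
  simp only [smul_eq_mul, mul_left_comm _ c, integral_const_mul]
  exact (hf t ht).const_mul c

lemma WeightFlow.sum {ι : Type*} {T : Finset ι} {f : ι → (Fin 2 → ℝ) → E} (hΩ : IsCompact Ω)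
    (hw : IsTimeWeight Ω w) (hfc : ∀ j, ContinuousOn (f j) Ω)
    (hf : ∀ j ∈ T, WeightFlow Ω w D (f j)) : WeightFlow Ω w D (fun z => ∑ j ∈ T, f j z) := by
  intro t ht
  have e : ∀ u : (Fin 2 → ℝ) → ℝ, IntegrableOn u Ω → ∫ z in Ω, u z • ∑ j ∈ T, f j z =
      ∑ j ∈ T, ∫ z in Ω, u z • f j z := by
    intro u hu
    simp only [Finset.smul_sum]
    exact integral_finsetSum _ fun j _ => integrableOn_smul hΩ hu (hfc j)
  rw [e _ (hw.integrableOn_rate hΩ ht (D t))]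
  exact (HasDerivWithinAt.fun_sum fun j hj => hf j hj t ht).congr
    (fun s hs => e _ (hw.integrable s hs)) (e _ (hw.integrable t ht))

/-- The rate of change of `∫ f w` is at most `K sup |f|`. -/
lemma WeightFlow.norm_sub_le {K C : ℝ} {g : (Fin 2 → ℝ) → ℝ} (hΩ : IsCompact Ω)
    (hw : IsTimeWeight Ω w) (hK : ∀ t, 0 ≤ t → ∀ z ∈ Ω, |D t - (z 0 + z 1)| ≤ K) (hK0 : 0 ≤ K)
    (hg : WeightFlow Ω w D g) (hC : ∀ z ∈ Ω, |g z| ≤ C) {s t : ℝ} (hs : 0 ≤ s) (ht : 0 ≤ t) :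
    |(∫ z in Ω, w s z • g z) - ∫ z in Ω, w t z • g z| ≤ K * C * |s - t| := by
  refine (convex_Ici (0 : ℝ)).norm_image_sub_le_of_norm_hasDerivWithin_le
    (f := fun s => ∫ z in Ω, w s z • g z) (fun t ht => hg t ht) (fun t ht => ?_) ht hs
  have e : ∫ z in Ω, ((D t - (z 0 + z 1)) * w t z) • g z =
      ∫ z in Ω, w t z • ((D t - (z 0 + z 1)) * g z) := by
    congr 1
    ext z
    simp only [smul_eq_mul]
    ring
  rw [e]
  refine hw.norm_integral_le hΩ ht fun z hz => ?_
  rw [Real.norm_eq_abs, abs_mul]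
  exact mul_le_mul (hK t ht z hz) (hC z hz) (abs_nonneg _) hK0

/-- The functions that satisfy the weak evolution equation are closed under uniform limits. -/
lemma WeightFlow.of_approx {K : ℝ} {f : (Fin 2 → ℝ) → ℝ} (hΩ : IsCompact Ω)
    (hw : IsTimeWeight Ω w) (hK : ∀ t, 0 ≤ t → ∀ z ∈ Ω, |D t - (z 0 + z 1)| ≤ K)
    (hf : ContinuousOn f Ω) (h : ∀ ε > 0, ∃ g, ContinuousOn g Ω ∧ WeightFlow Ω w D g ∧
      ∀ z ∈ Ω, |f z - g z| ≤ ε) : WeightFlow Ω w D f := by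
  intro t ht
  have hK0 : 0 ≤ K := by
    obtain ⟨z, hz⟩ := hw.nonempty
    exact (abs_nonneg _).trans (hK 0 le_rfl z hz)
  have hsub : ∀ {u f g : (Fin 2 → ℝ) → ℝ}, IntegrableOn u Ω → ContinuousOn f Ω →
      ContinuousOn g Ω → ∫ z in Ω, u z • (f z - g z) =
      (∫ z in Ω, u z • f z) - ∫ z in Ω, u z • g z := by
    intro u f g hu hf hg
    simp only [smul_sub]
    exact integral_sub (integrableOn_smul hΩ hu hf) (integrableOn_smul hΩ hu hg)
  -- The increment of `∫ (f - g) w` is Lipschitz in time with a constant proportional to `ε`: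
  -- compare `g` with a much better approximation `g'` of `f`.
  have hlip : ∀ ε > 0, ∀ g, ContinuousOn g Ω → WeightFlow Ω w D g →
      (∀ z ∈ Ω, |f z - g z| ≤ ε) → ∀ s, 0 ≤ s →
      |((∫ z in Ω, w s z • f z) - ∫ z in Ω, w s z • g z) -
        ((∫ z in Ω, w t z • f z) - ∫ z in Ω, w t z • g z)| ≤ K * ε * |s - t| := by
    intro ε hε g hgc hg hfg s hs
    refine le_of_forall_pos_le_add fun δ hδ => ?_
    have hc : 0 < 2 + K * |s - t| := by positivity
    obtain ⟨g', hgc', hg', hfg'⟩ := h (δ / (2 + K * |s - t|)) (div_pos hδ hc)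
    set η := δ / (2 + K * |s - t|) with hη
    have h1 : ∀ r, 0 ≤ r → |(∫ z in Ω, w r z • f z) - ∫ z in Ω, w r z • g' z| ≤ η := by
      intro r hr
      rw [← hsub (hw.integrable r hr) hf hgc']
      rw [← Real.norm_eq_abs]
      exact hw.norm_integral_le hΩ hr hfg'
    have h2 : ∀ z ∈ Ω, |g' z - g z| ≤ ε + η := by
      intro z hz
      have e : g' z - g z = (f z - g z) - (f z - g' z) := by ring
      rw [e]
      exact (abs_sub _ _).trans (add_le_add (hfg z hz) (hfg' z hz))
    have h3 := (hg'.sub hΩ hw hgc' hgc hg).norm_sub_le hΩ hw hK hK0 h2 hs ht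
    rw [hsub (hw.integrable s hs) hgc' hgc, hsub (hw.integrable t ht) hgc' hgc] at h3
    have h4 : η * (2 + K * |s - t|) = δ := div_mul_cancel₀ _ hc.ne'
    have h5 := h1 s hs
    have h6 := h1 t ht
    rw [abs_le] at *
    constructor <;> nlinarith
  rw [hasDerivWithinAt_iff_isLittleO, Asymptotics.isLittleO_iff]
  intro c hc
  have hε : 0 < c / (4 * (K + 1)) := by positivity
  obtain ⟨g, hgc, hg, hfg⟩ := h _ hε
  have hKε : K * (c / (4 * (K + 1))) ≤ c / 4 := by
    rw [mul_div_assoc', div_le_div_iff₀ (by positivity) (by norm_num)]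
    nlinarith
  have hg1 := hg t ht
  rw [hasDerivWithinAt_iff_isLittleO, Asymptotics.isLittleO_iff] at hg1
  have hrate : |(∫ z in Ω, ((D t - (z 0 + z 1)) * w t z) • f z) -
      ∫ z in Ω, ((D t - (z 0 + z 1)) * w t z) • g z| ≤ c / 4 := by
    rw [← hsub (hw.integrableOn_rate hΩ ht (D t)) hf hgc]
    have e : ∫ z in Ω, ((D t - (z 0 + z 1)) * w t z) • (f z - g z) =
        ∫ z in Ω, w t z • ((D t - (z 0 + z 1)) * (f z - g z)) := by
      congr 1
      ext z
      simp only [smul_eq_mul]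
      ring
    rw [e, ← Real.norm_eq_abs]
    refine (hw.norm_integral_le hΩ ht fun z hz => ?_).trans hKε
    rw [Real.norm_eq_abs, abs_mul]
    exact mul_le_mul (hK t ht z hz) (hfg z hz) (abs_nonneg _) hK0
  filter_upwards [hg1 (half_pos hc), self_mem_nhdsWithin] with s hs1 hs
  have h1 := hlip _ hε g hgc hg hfg s hs
  have h2 : K * (c / (4 * (K + 1))) * |s - t| ≤ c / 4 * |s - t| :=
    mul_le_mul_of_nonneg_right hKε (abs_nonneg _)
  simp only [Real.norm_eq_abs, smul_eq_mul] at hs1 h1 hrate ⊢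
  generalize (∫ z in Ω, (D t - (z 0 + z 1)) * w t z * f z) = a at *
  generalize (∫ z in Ω, (D t - (z 0 + z 1)) * w t z * g z) = b at *
  have h3 : |(s - t) * (a - b)| ≤ c / 4 * |s - t| := by
    rw [abs_mul, mul_comm]
    exact mul_le_mul_of_nonneg_right hrate (abs_nonneg _)
  have e : ∀ p q p' q' : ℝ, p - q - (s - t) * a =
      ((p - p') - (q - q')) + (p' - q' - (s - t) * b) - (s - t) * (a - b) := by
    intros
    ring
  rw [e _ _ (∫ z in Ω, w s z * g z) (∫ z in Ω, w t z * g z)]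
  refine (abs_sub _ _).trans ((add_le_add ((abs_add_le _ _).trans
    (add_le_add (h1.trans h2) hs1)) h3).trans (le_of_eq ?_))
  ring

/-- If the functions `m / (ζ - X)` satisfy the weak evolution equation for all large `ζ`, so do
the coefficients `m X ^ n` of their expansion at infinity. -/
lemma WeightFlow.pow_mul {K R : ℝ} {X m : (Fin 2 → ℝ) → ℝ} (hΩ : IsCompact Ω)
    (hw : IsTimeWeight Ω w) (hK : ∀ t, 0 ≤ t → ∀ z ∈ Ω, |D t - (z 0 + z 1)| ≤ K)
    (hX : ContinuousOn X Ω) (hXR : ∀ z ∈ Ω, |X z| ≤ R) (hm : ContinuousOn m Ω)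
    (h : ∀ ζ > R, WeightFlow Ω w D (fun z => m z * (ζ - X z)⁻¹)) (n : ℕ) :
    WeightFlow Ω w D (fun z => X z ^ n * m z) := by
  have hR : 0 ≤ R := by
    obtain ⟨z, hz⟩ := hw.nonempty
    exact (abs_nonneg _).trans (hXR z hz)
  obtain ⟨B, hB⟩ := hΩ.exists_bound_of_continuousOn hm
  have hB0 : 0 ≤ B := by
    obtain ⟨z, hz⟩ := hw.nonempty
    exact (norm_nonneg _).trans (hB z hz)
  induction n using Nat.strong_induction_on with
  | _ n ih =>
    refine WeightFlow.of_approx hΩ hw hK ((hX.pow n).mul hm) fun ε hε => ?_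
    set ζ : ℝ := R + 1 + R ^ (n + 1) * B / ε with hζ
    clear_value ζ
    have hq : 0 ≤ R ^ (n + 1) * B / ε := by positivity
    have hpos : ∀ z ∈ Ω, ζ - R ≤ ζ - X z := fun z hz => by
      linarith [(abs_le.1 (hXR z hz)).2]
    have hne : ∀ z ∈ Ω, ζ - X z ≠ 0 := fun z hz => by
      have := hpos z hz
      exact ne_of_gt (by linarith)
    have hc1 : ContinuousOn (fun z => ζ ^ (n + 1) * (m z * (ζ - X z)⁻¹)) Ω :=
      continuousOn_const.mul (hm.mul ((continuousOn_const.sub hX).inv₀ hne))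
    have hc2 : ∀ j, ContinuousOn (fun z => ζ * ζ ^ (n - 1 - j) * (X z ^ j * m z)) Ω := fun j =>
      continuousOn_const.mul ((hX.pow j).mul hm)
    refine ⟨fun z => ζ ^ (n + 1) * (m z * (ζ - X z)⁻¹) -
      ∑ j ∈ Finset.range n, ζ * ζ ^ (n - 1 - j) * (X z ^ j * m z),
      hc1.sub (continuousOn_finsetSum _ fun j _ => hc2 j),
      ((h ζ (by linarith)).const_mul _).sub hΩ hw hc1
        (continuousOn_finsetSum _ fun j _ => hc2 j)
        (WeightFlow.sum hΩ hw hc2 fun j hj => (ih j (Finset.mem_range.1 hj)).const_mul _),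
      fun z hz => ?_⟩
    -- The approximant is `ζ X ^ n m / (ζ - X)`, which tends to `X ^ n m` as `ζ → ∞`.
    have hgeom : ζ ^ (n + 1) * (m z * (ζ - X z)⁻¹) -
        ∑ j ∈ Finset.range n, ζ * ζ ^ (n - 1 - j) * (X z ^ j * m z) =
        ζ * X z ^ n * m z * (ζ - X z)⁻¹ := by
      have h1 := geom_sum₂_mul (X z) ζ n
      have h2 : ∑ j ∈ Finset.range n, ζ * ζ ^ (n - 1 - j) * (X z ^ j * m z) =
          ζ * m z * ∑ j ∈ Finset.range n, X z ^ j * ζ ^ (n - 1 - j) := by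
        rw [Finset.mul_sum]
        refine Finset.sum_congr rfl fun j _ => ?_
        ring
      rw [h2]
      have hz0 := hne z hz
      field_simp
      linear_combination (ζ * m z) * h1
    have herr : X z ^ n * m z - ζ * X z ^ n * m z * (ζ - X z)⁻¹ =
        -(X z ^ (n + 1) * m z * (ζ - X z)⁻¹) := by
      have hz0 := hne z hz
      field_simp
      ring
    dsimp only
    rw [hgeom, herr, abs_neg, abs_mul, abs_mul, abs_pow, abs_inv, ← div_eq_mul_inv]
    have hden : R ^ (n + 1) * B / ε ≤ |ζ - X z| :=
      le_trans (by linarith [hpos z hz]) (le_abs_self _)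
    have hnum : |X z| ^ (n + 1) * |m z| ≤ R ^ (n + 1) * B :=
      mul_le_mul (pow_le_pow_left₀ (abs_nonneg _) (hXR z hz) _) (hB z hz) (abs_nonneg _)
        (by positivity)
    rw [div_le_iff₀ (abs_pos.2 (hne z hz))]
    calc |X z| ^ (n + 1) * |m z| ≤ R ^ (n + 1) * B := hnum
      _ = ε * (R ^ (n + 1) * B / ε) := by field_simp
      _ ≤ ε * |ζ - X z| := mul_le_mul_of_nonneg_left hden hε.le

end Integration

/-! ### The Stieltjes function -/

section Stieltjes

variable {Ω : Set (Fin 2 → ℝ)} {w : ℝ → (Fin 2 → ℝ) → ℝ} {D : ℝ → ℝ}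

lemma sub_ofReal_ne_zero {ζ : ℂ} {x : ℝ} (h : |x| < ‖ζ‖) : ζ - (x : ℂ) ≠ 0 := by
  intro h0
  rw [sub_eq_zero] at h0
  rw [h0, Complex.norm_real, Real.norm_eq_abs] at h
  exact lt_irrefl _ h

lemma continuousOn_inv_sub {ζ : ℂ} {i : Fin 2} (h : ∀ z ∈ Ω, |z i| < ‖ζ‖) :
    ContinuousOn (fun z : Fin 2 → ℝ => (ζ - (z i : ℂ))⁻¹) Ω :=
  ContinuousOn.inv₀ (Continuous.continuousOn (by fun_prop)) fun z hz => sub_ofReal_ne_zero (h z hz)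

/-- The Laurent expansion of a marginal Stieltjes function at infinity; it converges since `Ω` is
compact and `|z i| < ‖ζ‖` on `Ω`. -/
lemma IsTimeWeight.integral_inv_sub (hΩ : IsCompact Ω) (hw : IsTimeWeight Ω w) {t : ℝ}
    (ht : 0 ≤ t) {ζ : ℂ} {i : Fin 2} (h : ∀ z ∈ Ω, |z i| < ‖ζ‖) :
    ∫ z in Ω, w t z • (ζ - (z i : ℂ))⁻¹ =
      ∑' n : ℕ, ((∫ z in Ω, z i ^ n * w t z : ℝ) : ℂ) / ζ ^ (n + 1) := by
  obtain ⟨z₀, hz₀, hmax⟩ := hΩ.exists_isMaxOn hw.nonempty (f := fun z : Fin 2 → ℝ => |z i|)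
    (Continuous.continuousOn (by fun_prop))
  set ρ := |z₀ i| with hρ
  have hρζ : ρ < ‖ζ‖ := h z₀ hz₀
  have hρ0 : 0 ≤ ρ := abs_nonneg _
  have hζ : 0 < ‖ζ‖ := hρ0.trans_lt hρζ
  have hζ0 : ζ ≠ 0 := norm_pos_iff.1 hζ
  have hint : ∀ n : ℕ, IntegrableOn (fun z => w t z • ((z i : ℂ) ^ n / ζ ^ (n + 1))) Ω := fun n =>
    integrableOn_smul hΩ (hw.integrable t ht) (Continuous.continuousOn (by fun_prop))
  have hbd : ∀ n : ℕ, ∫ z in Ω, ‖w t z • ((z i : ℂ) ^ n / ζ ^ (n + 1))‖ ≤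
      (ρ / ‖ζ‖) ^ n * ‖ζ‖⁻¹ := by
    intro n
    have h1 : ∫ z in Ω, (ρ / ‖ζ‖) ^ n * ‖ζ‖⁻¹ * w t z = (ρ / ‖ζ‖) ^ n * ‖ζ‖⁻¹ := by
      rw [integral_const_mul, hw.normalized t ht, mul_one]
    rw [← h1]
    refine setIntegral_mono_on (hint n).norm ((hw.integrable t ht).const_mul _)
      hΩ.measurableSet fun z hz => ?_
    rw [norm_smul, Real.norm_of_nonneg (hw.nonneg t ht z hz), mul_comm]
    refine mul_le_mul_of_nonneg_right ?_ (hw.nonneg t ht z hz)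
    rw [norm_div, norm_pow, norm_pow, Complex.norm_real, Real.norm_eq_abs, div_pow, pow_succ,
      div_mul_eq_div_div, ← div_eq_mul_inv]
    have hzρ : |z i| ≤ ρ := hmax hz
    gcongr
  have hsum : Summable fun n : ℕ => ∫ z in Ω, ‖w t z • ((z i : ℂ) ^ n / ζ ^ (n + 1))‖ :=
    Summable.of_nonneg_of_le (fun n => integral_nonneg fun z => norm_nonneg _) hbd
      ((summable_geometric_of_lt_one (by positivity) ((div_lt_one hζ).2 hρζ)).mul_right _)
  have key := (hasSum_integral_of_summable_integral_norm hint hsum).tsum_eq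
  have hpt : ∫ z in Ω, ∑' n : ℕ, w t z • ((z i : ℂ) ^ n / ζ ^ (n + 1)) =
      ∫ z in Ω, w t z • (ζ - (z i : ℂ))⁻¹ := by
    refine setIntegral_congr_fun hΩ.measurableSet fun z hz => ?_
    have hlt : ‖(z i : ℂ) / ζ‖ < 1 := by
      rw [norm_div, Complex.norm_real, Real.norm_eq_abs, div_lt_one hζ]
      exact h z hz
    have hne := sub_ofReal_ne_zero (h z hz)
    have h2 : HasSum (fun n : ℕ => (z i : ℂ) ^ n / ζ ^ (n + 1)) (ζ - (z i : ℂ))⁻¹ := by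
      have h3 := (hasSum_geometric_of_norm_lt_one hlt).mul_right ζ⁻¹
      have e1 : (1 - (z i : ℂ) / ζ)⁻¹ * ζ⁻¹ = (ζ - (z i : ℂ))⁻¹ := by
        rw [← mul_inv, sub_mul, div_mul_cancel₀ _ hζ0, one_mul]
      rw [e1] at h3
      refine h3.congr_fun fun n => ?_
      rw [div_pow, pow_succ, div_mul_eq_div_div, div_eq_mul_inv _ ζ]
    exact (h2.const_smul (w t z)).tsum_eq
  rw [← hpt, ← key]
  refine tsum_congr fun n => ?_
  have e : ∀ z : Fin 2 → ℝ, w t z • ((z i : ℂ) ^ n / ζ ^ (n + 1)) =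
      ((z i ^ n * w t z : ℝ) : ℂ) / ζ ^ (n + 1) := by
    intro z
    rw [Complex.real_smul]
    push_cast
    ring
  simp only [e]
  rw [integral_div, integral_complex_ofReal]

/-- The kernel of the Stieltjes function. -/
def stieltjesKernel (z₁ z₂ : ℂ) (z : Fin 2 → ℝ) : ℂ := (z₁ - (z 0 : ℂ))⁻¹ * (z₂ - (z 1 : ℂ))⁻¹

lemma stieltjes_eq (u : (Fin 2 → ℝ) → ℝ) (z₁ z₂ : ℂ) :
    stieltjes Ω u z₁ z₂ = ∫ z in Ω, u z • stieltjesKernel z₁ z₂ z := by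
  simp only [stieltjes, stieltjesKernel, Complex.real_smul, div_eq_mul_inv, mul_inv]

/-- The equation of the Stieltjes function is the weak evolution equation for its kernel. -/
lemma IsTimeWeight.stieltjes_rhs (hΩ : IsCompact Ω) (hw : IsTimeWeight Ω w) {t : ℝ} (ht : 0 ≤ t)
    (d : ℝ) {z₁ z₂ : ℂ} (h : ∀ z ∈ Ω, |z 0| < ‖z₁‖ ∧ |z 1| < ‖z₂‖) :
    ∫ z in Ω, ((d - (z 0 + z 1)) * w t z) • stieltjesKernel z₁ z₂ z =
      ((d : ℂ) - z₁ - z₂) * stieltjes Ω (w t) z₁ z₂ +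
        marginal₁ Ω (w t) 0 z₁ + marginal₂ Ω (w t) 0 z₂ := by
  have hc1 := continuousOn_inv_sub fun z hz => (h z hz).1
  have hc2 := continuousOn_inv_sub fun z hz => (h z hz).2
  have hm1 : marginal₁ Ω (w t) 0 z₁ = ∫ z in Ω, w t z • (z₁ - (z 0 : ℂ))⁻¹ := by
    rw [hw.integral_inv_sub hΩ ht fun z hz => (h z hz).1]
    simp [marginal₁, Toda2D.moment]
  have hm2 : marginal₂ Ω (w t) 0 z₂ = ∫ z in Ω, w t z • (z₂ - (z 1 : ℂ))⁻¹ := by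
    rw [hw.integral_inv_sub hΩ ht fun z hz => (h z hz).2]
    simp [marginal₂, Toda2D.moment]
  have i0 : IntegrableOn (fun z => ((d : ℂ) - z₁ - z₂) * w t z • stieltjesKernel z₁ z₂ z) Ω :=
    (integrableOn_smul hΩ (hw.integrable t ht) (hc1.mul hc2)).const_mul _
  have i1 := integrableOn_smul hΩ (hw.integrable t ht) hc1
  have i2 := integrableOn_smul hΩ (hw.integrable t ht) hc2
  have i01 : IntegrableOn (fun z => ((d : ℂ) - z₁ - z₂) * w t z • stieltjesKernel z₁ z₂ z +
      w t z • (z₁ - (z 0 : ℂ))⁻¹) Ω := Integrable.add i0 i1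
  rw [hm1, hm2, stieltjes_eq, ← integral_const_mul, ← integral_add i0 i1,
    ← integral_add i01 i2]
  refine setIntegral_congr_fun hΩ.measurableSet fun z hz => ?_
  have n1 := sub_ofReal_ne_zero (h z hz).1
  have n2 := sub_ofReal_ne_zero (h z hz).2
  simp only [stieltjesKernel, Complex.real_smul]
  push_cast
  field_simp
  ring

lemma stieltjes_flow_iff (hΩ : IsCompact Ω) (hw : IsTimeWeight Ω w) :
    (∀ t, 0 ≤ t → ∀ z₁ z₂ : ℂ, (∀ z ∈ Ω, |z 0| < ‖z₁‖ ∧ |z 1| < ‖z₂‖) →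
        HasDerivWithinAt (fun s => stieltjes Ω (w s) z₁ z₂)
          (((D t : ℝ) - z₁ - z₂) * stieltjes Ω (w t) z₁ z₂
            + marginal₁ Ω (w t) 0 z₁ + marginal₂ Ω (w t) 0 z₂) (Ici 0) t) ↔
      ∀ z₁ z₂ : ℂ, (∀ z ∈ Ω, |z 0| < ‖z₁‖ ∧ |z 1| < ‖z₂‖) →
        WeightFlow Ω w D (stieltjesKernel z₁ z₂) := by
  constructor
  · intro h z₁ z₂ hz t ht
    rw [hw.stieltjes_rhs hΩ ht _ hz]
    simpa only [stieltjes_eq] using h t ht z₁ z₂ hz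
  · intro h t ht z₁ z₂ hz
    rw [← hw.stieltjes_rhs hΩ ht _ hz]
    simpa only [stieltjes_eq] using h z₁ z₂ hz t ht

/-- The weak evolution equation for the Stieltjes kernels implies the one for the monomials, which
are the coefficients of the kernels at infinity; real arguments of the kernels suffice. -/
lemma WeightFlow.monomial_of_stieltjesKernel {K : ℝ} (hΩ : IsCompact Ω) (hw : IsTimeWeight Ω w)
    (hK : ∀ t, 0 ≤ t → ∀ z ∈ Ω, |D t - (z 0 + z 1)| ≤ K)
    (h : ∀ z₁ z₂ : ℂ, (∀ z ∈ Ω, |z 0| < ‖z₁‖ ∧ |z 1| < ‖z₂‖) →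
        WeightFlow Ω w D (stieltjesKernel z₁ z₂)) (m n : ℕ) :
    WeightFlow Ω w D (fun z => z 0 ^ m * z 1 ^ n) := by
  obtain ⟨R, hR0, hR⟩ := exists_abs_coord_le hΩ
  have hreal : ∀ a > R, ∀ b > R, WeightFlow Ω w D (fun z => (b - z 1)⁻¹ * (a - z 0)⁻¹) := by
    intro a ha b hb t ht
    have hab := h a b fun z hz => by
      simp only [Complex.norm_real, Real.norm_eq_abs]
      exact ⟨(hR z hz 0).trans_lt (ha.trans_le (le_abs_self a)),
        (hR z hz 1).trans_lt (hb.trans_le (le_abs_self b))⟩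
    have e : ∀ u : (Fin 2 → ℝ) → ℝ, ∫ z in Ω, u z • stieltjesKernel a b z =
        ((∫ z in Ω, u z • ((b - z 1)⁻¹ * (a - z 0)⁻¹) : ℝ) : ℂ) := by
      intro u
      rw [← integral_complex_ofReal]
      congr 1
      ext z
      simp only [stieltjesKernel, Complex.real_smul, smul_eq_mul]
      push_cast
      ring
    have h1 := hab t ht
    simp only [e] at h1
    have h2 := Complex.reCLM.hasFDerivAt.comp_hasDerivWithinAt t h1
    simpa [Function.comp_def] using h2
  have hcont : ∀ b > R, ∀ i : Fin 2, ContinuousOn (fun z : Fin 2 → ℝ => (b - z i)⁻¹) Ω :=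
    fun b hb i => ContinuousOn.inv₀ (Continuous.continuousOn (by fun_prop)) fun z hz => by
      have := (abs_le.1 (hR z hz i)).2
      exact ne_of_gt (by linarith)
  have h1 : ∀ b > R, WeightFlow Ω w D (fun z => z 0 ^ m * (b - z 1)⁻¹) := fun b hb =>
    WeightFlow.pow_mul hΩ hw hK (X := fun z => z 0) (Continuous.continuousOn (by fun_prop))
      (fun z hz => hR z hz 0) (hcont b hb 1) (fun a ha => hreal a ha b hb) m
  have h2 := WeightFlow.pow_mul hΩ hw hK (X := fun z => z 1) (m := fun z => z 0 ^ m)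
    (Continuous.continuousOn (by fun_prop)) (fun z hz => hR z hz 1)
    (Continuous.continuousOn (by fun_prop)) h1 n
  exact h2.congr hΩ fun z _ => mul_comm _ _

end Stieltjes

/-! ### The weight -/

section Weight

variable {Ω : Set (Fin 2 → ℝ)} {w : ℝ → (Fin 2 → ℝ) → ℝ} {D : ℝ → ℝ} {E : Type*}
  [NormedAddCommGroup E] [NormedSpace ℝ E]

/-- The unnormalized weight `e^(-(x+y)t) u(x,y)`. -/
def expWeight (u : (Fin 2 → ℝ) → ℝ) (t : ℝ) (z : Fin 2 → ℝ) : ℝ :=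
  Real.exp (-(z 0 + z 1) * t) * u z

/-- The weight is the normalization of `e^(-(x+y)t) w(x,y,0)`. -/
def ExplicitWeight (Ω : Set (Fin 2 → ℝ)) (w : ℝ → (Fin 2 → ℝ) → ℝ) : Prop :=
  ∀ᵐ z ∂(volume.restrict Ω), ∀ t, 0 ≤ t →
    w t z = expWeight (w 0) t z / ∫ v in Ω, expWeight (w 0) t v

/-- The evolution `ẇ = -(x + y - D) w` almost everywhere. -/
def WeightODE (Ω : Set (Fin 2 → ℝ)) (w : ℝ → (Fin 2 → ℝ) → ℝ) (D : ℝ → ℝ) : Prop :=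
  ∀ᵐ z ∂(volume.restrict Ω), ∀ t, 0 ≤ t →
    HasDerivWithinAt (fun s => w s z) (-(z 0 + z 1 - D t) * w t z) (Ici 0) t

lemma integrableOn_expWeight (hΩ : IsCompact Ω) {u : (Fin 2 → ℝ) → ℝ} (hu : IntegrableOn u Ω)
    (t : ℝ) : IntegrableOn (expWeight u t) Ω :=
  integrableOn_mul hΩ hu (Continuous.continuousOn (by fun_prop))

lemma hasDerivAt_expWeight (u : (Fin 2 → ℝ) → ℝ) (z : Fin 2 → ℝ) (t : ℝ) :
    HasDerivAt (fun s => expWeight u s z) (-(z 0 + z 1) * expWeight u t z) t := by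
  have h := (((hasDerivAt_id t).const_mul (-(z 0 + z 1))).exp).mul_const (u z)
  refine h.congr_deriv ?_
  simp only [expWeight, id]
  ring

lemma abs_exponent_le {R : ℝ} {z : Fin 2 → ℝ} (hz : ∀ i, |z i| ≤ R) : |z 0 + z 1| ≤ 2 * R :=
  (abs_add_le _ _).trans (by linarith [hz 0, hz 1])

lemma norm_expWeight_le {R : ℝ} {z : Fin 2 → ℝ} (hz : ∀ i, |z i| ≤ R) (u : (Fin 2 → ℝ) → ℝ)
    (t : ℝ) : |expWeight u t z| ≤ Real.exp (2 * R * |t|) * |u z| := by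
  rw [expWeight, abs_mul, Real.abs_exp]
  refine mul_le_mul_of_nonneg_right (Real.exp_le_exp.2 ?_) (abs_nonneg _)
  refine (le_abs_self _).trans ?_
  rw [abs_mul, abs_neg]
  exact mul_le_mul_of_nonneg_right (abs_exponent_le hz) (abs_nonneg _)

lemma hasDerivAt_integral_expWeight (hΩ : IsCompact Ω) {u : (Fin 2 → ℝ) → ℝ}
    (hu : IntegrableOn u Ω) {f : (Fin 2 → ℝ) → E} (hf : ContinuousOn f Ω) (t : ℝ) :
    HasDerivAt (fun s => ∫ z in Ω, expWeight u s z • f z)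
      (∫ z in Ω, (-(z 0 + z 1) * expWeight u t z) • f z) t := by
  obtain ⟨R, hR0, hR⟩ := exists_abs_coord_le hΩ
  obtain ⟨B, hB⟩ := hΩ.exists_bound_of_continuousOn hf
  have hi : ∀ s, IntegrableOn (fun z => expWeight u s z • f z) Ω := fun s =>
    integrableOn_smul hΩ (integrableOn_expWeight hΩ hu s) hf
  refine (hasDerivAt_integral_of_dominated_loc_of_deriv_le (𝕜 := ℝ) (s := Metric.ball t 1)
    (bound := fun z => 2 * R * (Real.exp (2 * R * (|t| + 1)) * |u z|) * B)
    (F := fun s z => expWeight u s z • f z)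
    (F' := fun s z => (-(z 0 + z 1) * expWeight u s z) • f z) (Metric.ball_mem_nhds t one_pos)
    (Filter.Eventually.of_forall fun s => (hi s).aestronglyMeasurable) (hi t) ?_ ?_ ?_ ?_).2
  · exact (integrableOn_smul hΩ (integrableOn_mul hΩ (integrableOn_expWeight hΩ hu t)
      (Continuous.continuousOn (by fun_prop))) hf).aestronglyMeasurable
  · filter_upwards [ae_restrict_mem hΩ.measurableSet] with z hz s hs
    have hs' : |s| ≤ |t| + 1 := by
      rw [Metric.mem_ball, Real.dist_eq] at hs
      have := abs_sub_abs_le_abs_sub s t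
      linarith
    rw [norm_smul, Real.norm_eq_abs, abs_mul, abs_neg]
    have h1 : |expWeight u s z| ≤ Real.exp (2 * R * (|t| + 1)) * |u z| :=
      (norm_expWeight_le (hR z hz) u s).trans (mul_le_mul_of_nonneg_right
        (Real.exp_le_exp.2 (mul_le_mul_of_nonneg_left hs' (by positivity))) (abs_nonneg _))
    exact mul_le_mul (mul_le_mul (abs_exponent_le (hR z hz)) h1 (abs_nonneg _) (by positivity))
      (hB z hz) (norm_nonneg _) (by positivity)
  · exact ((hu.abs.const_mul _).const_mul _).mul_const _
  · exact Filter.Eventually.of_forall fun z s _ =>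
      (hasDerivAt_expWeight u z s).smul_const (f z)

lemma ExplicitWeight.normalization_ne_zero (h : ExplicitWeight Ω w) (hw : IsTimeWeight Ω w)
    {t : ℝ} (ht : 0 ≤ t) : ∫ v in Ω, expWeight (w 0) t v ≠ 0 := by
  intro h0
  have h1 := hw.normalized t ht
  rw [integral_congr_ae (h.mono fun z hz => hz t ht)] at h1
  simp [h0] at h1

lemma ExplicitWeight.integral_eq (h : ExplicitWeight Ω w) {t : ℝ} (ht : 0 ≤ t)
    (c : (Fin 2 → ℝ) → ℝ) (f : (Fin 2 → ℝ) → E) : ∫ z in Ω, (c z * w t z) • f z =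
      (∫ v in Ω, expWeight (w 0) t v)⁻¹ • ∫ z in Ω, (c z * expWeight (w 0) t z) • f z := by
  rw [← integral_smul]
  refine integral_congr_ae (h.mono fun z hz => ?_)
  simp only [hz t ht, smul_smul]
  congr 1
  ring

/-- The logarithmic derivative of the normalization is `-D`. -/
lemma ExplicitWeight.hasDerivAt_normalization (hΩ : IsCompact Ω) (hw : IsTimeWeight Ω w)
    (hD : ∀ t, 0 ≤ t → D t = ∫ z in Ω, (z 0 + z 1) * w t z) (h : ExplicitWeight Ω w) {t : ℝ}
    (ht : 0 ≤ t) : HasDerivAt (fun s => ∫ v in Ω, expWeight (w 0) s v)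
      (-D t * ∫ v in Ω, expWeight (w 0) t v) t := by
  have h1 := hasDerivAt_integral_expWeight hΩ (hw.integrable 0 le_rfl)
    (continuousOn_const (c := (1 : ℝ))) t
  simp only [smul_eq_mul, mul_one] at h1
  refine h1.congr_deriv ?_
  have h2 := h.integral_eq ht (fun z => z 0 + z 1) (fun _ => (1 : ℝ))
  simp only [smul_eq_mul, mul_one] at h2
  rw [hD t ht, h2]
  simp only [neg_mul, integral_neg]
  have := h.normalization_ne_zero hw ht
  field_simp

lemma ExplicitWeight.weightFlow (hΩ : IsCompact Ω) (hw : IsTimeWeight Ω w)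
    (hD : ∀ t, 0 ≤ t → D t = ∫ z in Ω, (z 0 + z 1) * w t z) (h : ExplicitWeight Ω w)
    {f : (Fin 2 → ℝ) → E} (hf : ContinuousOn f Ω) : WeightFlow Ω w D f := by
  intro t ht
  have hZ := h.normalization_ne_zero hw ht
  have h1 := ((h.hasDerivAt_normalization hΩ hw hD ht).inv hZ).smul
    (hasDerivAt_integral_expWeight hΩ (hw.integrable 0 le_rfl) hf t)
  have e : ∀ s, 0 ≤ s → ∫ z in Ω, w s z • f z =
      (∫ v in Ω, expWeight (w 0) s v)⁻¹ • ∫ z in Ω, expWeight (w 0) s z • f z := by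
    intro s hs
    simpa using h.integral_eq hs (fun _ => 1) f
  refine (h1.hasDerivWithinAt.congr (fun s hs => e s hs) (e t ht)).congr_deriv ?_
  have hi := integrableOn_smul hΩ (integrableOn_expWeight hΩ (hw.integrable 0 le_rfl) t) hf
  have hi' := integrableOn_smul hΩ (integrableOn_mul hΩ
    (integrableOn_expWeight hΩ (hw.integrable 0 le_rfl) t) (f := fun z => -(z 0 + z 1))
      (Continuous.continuousOn (by fun_prop))) hf
  have e2 : ∫ z in Ω, ((D t - (z 0 + z 1)) * expWeight (w 0) t z) • f z =
      D t • (∫ z in Ω, expWeight (w 0) t z • f z) +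
        ∫ z in Ω, (-(z 0 + z 1) * expWeight (w 0) t z) • f z := by
    have hi2 : IntegrableOn (fun z => D t • expWeight (w 0) t z • f z) Ω := hi.smul (D t)
    rw [← integral_smul, ← integral_add hi2 hi']
    congr 1
    ext z
    rw [smul_smul, ← add_smul]
    congr 1
    ring
  rw [h.integral_eq ht (fun z => D t - (z 0 + z 1)) f, e2, smul_add, smul_smul, add_comm]
  congr 2
  field_simp

lemma ExplicitWeight.weightODE (hΩ : IsCompact Ω) (hw : IsTimeWeight Ω w)
    (hD : ∀ t, 0 ≤ t → D t = ∫ z in Ω, (z 0 + z 1) * w t z) (h : ExplicitWeight Ω w) :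
    WeightODE Ω w D := by
  filter_upwards [h] with z hz t ht
  have hZ := h.normalization_ne_zero hw ht
  have h1 := (hasDerivAt_expWeight (w 0) z t).div (h.hasDerivAt_normalization hΩ hw hD ht) hZ
  refine (h1.hasDerivWithinAt.congr (fun s hs => hz s hs) (hz t ht)).congr_deriv ?_
  rw [hz t ht]
  field_simp
  ring

/-- A solution of `ġ = D g` on `[0, ∞)` with bounded `D` that vanishes at `0` is zero. -/
lemma eq_zero_of_linear_ode {g : ℝ → ℝ} {K : ℝ} (hK : ∀ t, 0 ≤ t → |D t| ≤ K)
    (hg : ∀ t, 0 ≤ t → HasDerivWithinAt g (D t * g t) (Ici 0) t) (h0 : g 0 = 0) {t : ℝ}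
    (ht : 0 ≤ t) : g t = 0 := by
  refine eq_zero_of_abs_deriv_le_mul_abs_self_of_eq_zero_right (a := 0) (b := t) (K := K)
    (f' := fun s => D s * g s) ?_ ?_ h0 ?_ t ⟨ht, le_rfl⟩
  · intro s hs
    exact (hg s hs.1).continuousWithinAt.mono fun r hr => hr.1
  · intro s hs
    exact (hg s hs.1).mono fun r hr => hs.1.trans hr
  · intro s hs
    rw [norm_mul]
    exact mul_le_mul_of_nonneg_right (hK s hs.1) (norm_nonneg _)

/-- The functions `e^((x+y)t) w` all solve the same scalar equation `ġ = D g`, hence are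
proportional; normalization determines the factor. -/
lemma WeightODE.explicitWeight (hw : IsTimeWeight Ω w) {K : ℝ}
    (hK : ∀ t, 0 ≤ t → |D t| ≤ K) (h : WeightODE Ω w D) : ExplicitWeight Ω w := by
  set g : (Fin 2 → ℝ) → ℝ → ℝ := fun z t => Real.exp ((z 0 + z 1) * t) * w t z with hgdef
  have hg : ∀ᵐ z ∂(volume.restrict Ω), ∀ t, 0 ≤ t →
      HasDerivWithinAt (g z) (D t * g z t) (Ici 0) t := by
    filter_upwards [h] with z hz t ht
    have h1 := (((hasDerivAt_id t).const_mul (z 0 + z 1)).exp).hasDerivWithinAt.mul (hz t ht)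
    refine h1.congr_deriv ?_
    simp only [hgdef, id]
    ring
  -- A reference point with positive weight exists because `w 0` has integral `1`.
  obtain ⟨z₀, hz₀, hpos⟩ : ∃ z₀, (∀ t, 0 ≤ t →
      HasDerivWithinAt (g z₀) (D t * g z₀ t) (Ici 0) t) ∧ 0 < w 0 z₀ := by
    by_contra hcon
    push Not at hcon
    have : ∫ z in Ω, w 0 z ≤ 0 := integral_nonpos_of_ae (hg.mono fun z hz => hcon z hz)
    rw [hw.normalized 0 le_rfl] at this
    linarith
  set φ : ℝ → ℝ := fun t => g z₀ t / w 0 z₀ with hφ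
  have hprop : ∀ᵐ z ∂(volume.restrict Ω), ∀ t, 0 ≤ t → w t z = expWeight (w 0) t z * φ t := by
    filter_upwards [hg] with z hz t ht
    have h0 : g z t - w 0 z * φ t = 0 := by
      refine eq_zero_of_linear_ode (g := fun s => g z s - w 0 z * φ s) hK (fun s hs => ?_) ?_ ht
      · refine ((hz s hs).sub (((hz₀ s hs).div_const (w 0 z₀)).const_mul (w 0 z))).congr_deriv ?_
        simp only [hφ]
        ring
      · simp only [hφ, hgdef, mul_zero, Real.exp_zero, one_mul]
        rw [div_self hpos.ne']
        ring
    have h1 : w t z = Real.exp (-(z 0 + z 1) * t) * g z t := by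
      simp only [hgdef]
      rw [← mul_assoc, ← Real.exp_add, neg_mul, neg_add_cancel, Real.exp_zero, one_mul]
    rw [h1, sub_eq_zero.1 h0, expWeight]
    ring
  have hZ : ∀ t, 0 ≤ t → (∫ v in Ω, expWeight (w 0) t v) * φ t = 1 := by
    intro t ht
    rw [← hw.normalized t ht, integral_congr_ae (hprop.mono fun z hz => hz t ht),
      integral_mul_const]
  filter_upwards [hprop] with z hz t ht
  rw [hz t ht, eq_div_iff (left_ne_zero_of_mul_eq_one (hZ t ht)), mul_assoc, mul_comm (φ t),
    hZ t ht, mul_one]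

end Weight

/-! ### Recovering the weight from its moments -/

section Determinacy

variable {Ω : Set (Fin 2 → ℝ)} {w : ℝ → (Fin 2 → ℝ) → ℝ} {D : ℝ → ℝ}

lemma exists_poly_near (hΩ : IsCompact Ω) {f : (Fin 2 → ℝ) → ℝ} (hf : ContinuousOn f Ω) {ε : ℝ}
    (hε : 0 < ε) : ∃ p : Poly₂, ∀ z ∈ Ω, |eval z p - f z| ≤ ε := by
  have := isCompact_iff_compactSpace.1 hΩ
  set v : Fin 2 → C(Ω, ℝ) := fun i => ⟨fun z => (z : Fin 2 → ℝ) i,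
    (continuous_apply i).comp continuous_subtype_val⟩ with hv
  have hev : ∀ (p : Poly₂) (z : Ω), (aeval v p) z = eval (z : Fin 2 → ℝ) p := by
    intro p z
    induction p using MvPolynomial.induction_on with
    | C c => simp
    | add p q hp hq => simp [hp, hq]
    | mul_X p i hp => rw [map_mul, ContinuousMap.mul_apply, hp, aeval_X, eval_mul, eval_X]; rfl
  have hsep : (aeval v : Poly₂ →ₐ[ℝ] C(Ω, ℝ)).range.SeparatesPoints := by
    intro x y hxy
    obtain ⟨i, hi⟩ := Function.ne_iff.1 (Subtype.coe_injective.ne hxy)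
    refine ⟨v i, ⟨v i, ⟨X i, aeval_X v i⟩, rfl⟩, hi⟩
  obtain ⟨⟨g, p, rfl⟩, hg⟩ :=
    ContinuousMap.exists_mem_subalgebra_near_continuous_of_separatesPoints _ hsep
      (Ω.domRestrict f) hf.domRestrict ε hε
  refine ⟨p, fun z hz => ?_⟩
  have := hg ⟨z, hz⟩
  rw [← hev p ⟨z, hz⟩]
  exact this.le

/-- An integrable function on a compact set whose moments all vanish is zero almost everywhere. -/
lemma ae_eq_zero_of_moments (hΩ : IsCompact Ω) {g : (Fin 2 → ℝ) → ℝ} (hg : IntegrableOn g Ω)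
    (h : ∀ p : Poly₂, ∫ z in Ω, g z * eval z p = 0) :
    ∀ᵐ z ∂(volume.restrict Ω), g z = 0 := by
  refine ae_eq_zero_of_integral_contDiff_smul_eq_zero (Integrable.locallyIntegrable hg)
    fun f hf _ => ?_
  have hfc : ContinuousOn f Ω := hf.continuous.continuousOn
  rw [← abs_eq_zero]
  refine le_antisymm (le_of_forall_pos_le_add fun ε hε => ?_) (abs_nonneg _)
  have hc : 0 < (∫ z in Ω, |g z|) + 1 :=
    add_pos_of_nonneg_of_pos (integral_nonneg fun z => abs_nonneg _) one_pos
  obtain ⟨p, hp⟩ := exists_poly_near hΩ hfc (div_pos hε hc)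
  have e : ∫ z in Ω, f z • g z = ∫ z in Ω, g z * (f z - eval z p) := by
    have i1 : IntegrableOn (fun z => g z * f z) Ω := integrableOn_smul hΩ hg hfc
    have i2 : IntegrableOn (fun z => g z * eval z p) Ω :=
      integrableOn_smul hΩ hg (continuous_eval p).continuousOn
    simp only [mul_sub]
    rw [integral_sub i1 i2, h p, sub_zero]
    simp only [smul_eq_mul, mul_comm]
  rw [e, zero_add, ← Real.norm_eq_abs]
  refine (norm_integral_le_of_norm_le (g := fun z => |g z| * (ε / ((∫ z in Ω, |g z|) + 1)))
    (Integrable.mul_const hg.abs _) ?_).trans ?_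
  · filter_upwards [ae_restrict_mem hΩ.measurableSet] with z hz
    rw [norm_mul, Real.norm_eq_abs, Real.norm_eq_abs, abs_sub_comm]
    exact mul_le_mul_of_nonneg_left (hp z hz) (abs_nonneg _)
  · rw [integral_mul_const, mul_div_assoc', div_le_iff₀ hc]
    nlinarith

/-- The functions of a chain `ȧ_n = -a_(n+1)` with zero initial values and geometric bounds in
`n` vanish: iterated integration gives `|a_0(t)| ≤ C (R t)^k / k!` for every `k`. -/
lemma eq_zero_of_deriv_chain {a : ℕ → ℝ → ℝ} {C R T : ℝ} (hT : 0 ≤ T)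
    (h : ∀ n t, 0 ≤ t → HasDerivWithinAt (a n) (-a (n + 1) t) (Ici 0) t) (h0 : ∀ n, a n 0 = 0)
    (hb : ∀ n, ∀ t ∈ Icc 0 T, |a n t| ≤ C * R ^ n) : a 0 T = 0 := by
  have key : ∀ k n, ∀ t ∈ Icc 0 T, |a n t| ≤ C * R ^ (n + k) * (t ^ k / k.factorial) := by
    intro k
    induction k with
    | zero =>
      intro n t ht
      simpa using hb n t ht
    | succ k ih =>
      intro n t ht
      refine image_norm_le_of_norm_deriv_right_le_deriv_boundary (f := a n)
        (f' := fun s => -a (n + 1) s)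
        (B := fun s => C * R ^ (n + (k + 1)) * (s ^ (k + 1) / (k + 1).factorial))
        (B' := fun s => C * R ^ (n + (k + 1)) * (s ^ k / k.factorial)) ?_ ?_ ?_ ?_ ?_ ht
      · intro s hs
        exact (h n s hs.1).continuousWithinAt.mono fun r hr => hr.1
      · intro s hs
        exact (h n s hs.1).mono fun r hr => hs.1.trans hr
      · simp [h0]
      · intro s
        refine (((hasDerivAt_pow (k + 1) s).div_const _).const_mul _).congr_deriv ?_
        have : (k.factorial : ℝ) ≠ 0 := by positivity
        rw [Nat.factorial_succ]
        push_cast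
        field_simp
      · intro s hs
        rw [norm_neg, Real.norm_eq_abs]
        have := ih (n + 1) s ⟨hs.1, hs.2.le⟩
        rwa [add_assoc, add_comm 1 k] at this
  have hlim : Filter.Tendsto (fun k : ℕ => C * ((R * T) ^ k / k.factorial)) Filter.atTop
      (nhds 0) := by
    simpa using (FloorSemiring.tendsto_pow_div_factorial_atTop (R * T)).const_mul C
  have h1 : |a 0 T| ≤ 0 := by
    refine ge_of_tendsto' hlim fun k => ?_
    have := key k 0 T ⟨hT, le_rfl⟩
    rwa [zero_add, mul_assoc, ← mul_div_assoc, ← mul_pow] at this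
  exact abs_eq_zero.1 (le_antisymm h1 (abs_nonneg _))

/-- The weak evolution equation for polynomials determines the integrals of polynomials, up to a
common factor depending on time. -/
lemma exists_factor_of_weightFlow (hΩ : IsCompact Ω) (hw : IsTimeWeight Ω w)
    (hDc : ContinuousOn D (Ici 0)) (h : ∀ p : Poly₂, WeightFlow Ω w D (fun z => eval z p)) :
    ∃ c : ℝ → ℝ, ∀ t, 0 ≤ t → ∀ p : Poly₂,
      c t * ∫ z in Ω, w t z * eval z p = ∫ z in Ω, expWeight (w 0) t z * eval z p := by
  have hDc' : Continuous fun t => D (max t 0) :=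
    hDc.comp_continuous (by fun_prop) fun t => le_max_right t 0
  set c : ℝ → ℝ := fun t => Real.exp (-∫ s in (0 : ℝ)..t, D (max s 0)) with hcdef
  have hc : ∀ t, 0 ≤ t → HasDerivAt c (-D t * c t) t := by
    intro t ht
    have h1 := ((intervalIntegral.integral_hasDerivAt_right
      (hDc'.intervalIntegrable 0 t) (hDc'.stronglyMeasurableAtFilter _ _)
      hDc'.continuousAt).neg).exp
    refine h1.congr_deriv ?_
    simp only [max_eq_left ht, hcdef, Pi.neg_apply]
    ring
  refine ⟨c, fun T hT p => ?_⟩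
  obtain ⟨R, hR0, hR⟩ := exists_abs_coord_le hΩ
  obtain ⟨B, hB⟩ := hΩ.exists_bound_of_continuousOn (continuous_eval p).continuousOn
  obtain ⟨M, hM⟩ := (isCompact_Icc (a := (0 : ℝ)) (b := T)).exists_bound_of_continuousOn (f := c)
    fun t ht => (hc t ht.1).continuousAt.continuousWithinAt
  have hM0 : 0 ≤ M := (norm_nonneg _).trans (hM 0 ⟨le_rfl, hT⟩)
  set q : ℕ → Poly₂ := fun n => (X 0 + X 1) ^ n * p with hq
  have hqe : ∀ n z, eval z (q (n + 1)) = (z 0 + z 1) * eval z (q n) := by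
    intro n z
    simp only [hq, pow_succ', map_mul, map_add, eval_X]
    ring
  have hqb : ∀ n, ∀ z ∈ Ω, |eval z (q n)| ≤ (2 * R) ^ n * B := by
    intro n z hz
    simp only [hq, map_mul, map_pow, map_add, eval_X, abs_mul, abs_pow]
    exact mul_le_mul (pow_le_pow_left₀ (abs_nonneg _) (abs_exponent_le (hR z hz)) n) (hB z hz)
      (abs_nonneg _) (by positivity)
  set a : ℕ → ℝ → ℝ := fun n t => c t * (∫ z in Ω, w t z • eval z (q n)) -
    ∫ z in Ω, expWeight (w 0) t z • eval z (q n) with ha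
  have hzero : a 0 T = 0 := by
    refine eq_zero_of_deriv_chain (C := (M + Real.exp (2 * R * T)) * B) (R := 2 * R) hT
      (fun n t ht => ?_) (fun n => ?_) fun n t ht => ?_
    · have h1 := ((hc t ht).hasDerivWithinAt.mul (h (q n) t ht)).sub
        (hasDerivAt_integral_expWeight hΩ (hw.integrable 0 le_rfl)
          (continuous_eval (q n)).continuousOn t).hasDerivWithinAt
      refine h1.congr_deriv ?_
      have i1 : IntegrableOn (fun z => D t * (w t z * eval z (q n))) Ω :=
        (integrableOn_smul hΩ (hw.integrable t ht) (continuous_eval (q n)).continuousOn).const_mul _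
      have i2 : IntegrableOn (fun z => w t z * eval z (q (n + 1))) Ω :=
        integrableOn_smul hΩ (hw.integrable t ht) (continuous_eval (q (n + 1))).continuousOn
      have e1 : ∫ z in Ω, ((D t - (z 0 + z 1)) * w t z) • eval z (q n) =
          D t * (∫ z in Ω, w t z • eval z (q n)) - ∫ z in Ω, w t z • eval z (q (n + 1)) := by
        simp only [smul_eq_mul]
        rw [← integral_const_mul, ← integral_sub i1 i2]
        congr 1
        ext z
        rw [hqe]
        ring
      have e2 : ∫ z in Ω, (-(z 0 + z 1) * expWeight (w 0) t z) • eval z (q n) =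
          -∫ z in Ω, expWeight (w 0) t z • eval z (q (n + 1)) := by
        simp only [smul_eq_mul]
        rw [← integral_neg]
        congr 1
        ext z
        rw [hqe]
        ring
      rw [e1, e2, ha]
      ring
    · simp [ha, hcdef, expWeight]
    · have b1 : |∫ z in Ω, w t z • eval z (q n)| ≤ (2 * R) ^ n * B := by
        rw [← Real.norm_eq_abs]
        exact hw.norm_integral_le hΩ ht.1 (hqb n)
      have b2 : |∫ z in Ω, expWeight (w 0) t z • eval z (q n)| ≤
          Real.exp (2 * R * T) * ((2 * R) ^ n * B) := by
        have e : ∀ z, expWeight (w 0) t z • eval z (q n) =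
            w 0 z • (Real.exp (-(z 0 + z 1) * t) * eval z (q n)) := by
          intro z
          simp only [expWeight, smul_eq_mul]
          ring
        simp only [e]
        rw [← Real.norm_eq_abs]
        refine hw.norm_integral_le hΩ le_rfl fun z hz => ?_
        rw [Real.norm_eq_abs, abs_mul, Real.abs_exp]
        refine mul_le_mul (Real.exp_le_exp.2 ?_) (hqb n z hz) (abs_nonneg _) (Real.exp_nonneg _)
        refine (le_abs_self _).trans ?_
        rw [abs_mul, abs_neg, abs_of_nonneg ht.1]
        exact mul_le_mul (abs_exponent_le (hR z hz)) ht.2 ht.1 (by positivity)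
      have b3 : |c t * ∫ z in Ω, w t z • eval z (q n)| ≤ M * ((2 * R) ^ n * B) := by
        rw [abs_mul]
        exact mul_le_mul (hM t ht) b1 (abs_nonneg _) hM0
      calc |a n t| ≤ _ := abs_sub _ _
        _ ≤ _ := add_le_add b3 b2
        _ = _ := by ring
  have := sub_eq_zero.1 hzero
  simpa [hq] using this

lemma explicitWeight_of_weightFlow (hΩ : IsCompact Ω) (hw : IsTimeWeight Ω w)
    (hDc : ContinuousOn D (Ici 0)) (h : ∀ p : Poly₂, WeightFlow Ω w D (fun z => eval z p)) :
    ExplicitWeight Ω w := by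
  obtain ⟨c, hc⟩ := exists_factor_of_weightFlow hΩ hw hDc h
  have hcZ : ∀ t, 0 ≤ t → c t = ∫ z in Ω, expWeight (w 0) t z := by
    intro t ht
    have := hc t ht 1
    simpa [hw.normalized t ht] using this
  have hpt : ∀ t, 0 ≤ t → ∀ᵐ z ∂(volume.restrict Ω),
      c t * w t z - expWeight (w 0) t z = 0 := by
    intro t ht
    have hi := integrableOn_expWeight hΩ (hw.integrable 0 le_rfl) t
    refine ae_eq_zero_of_moments hΩ (((hw.integrable t ht).const_mul (c t)).sub hi) fun p => ?_
    have i1 : IntegrableOn (fun z => c t * (w t z * eval z p)) Ω :=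
      (integrableOn_smul hΩ (hw.integrable t ht) (continuous_eval p).continuousOn).const_mul _
    have i2 : IntegrableOn (fun z => expWeight (w 0) t z * eval z p) Ω :=
      integrableOn_smul hΩ hi (continuous_eval p).continuousOn
    simp only [sub_mul, mul_assoc]
    rw [integral_sub i1 i2, integral_const_mul, hc t ht p, sub_self]
  -- The normalization does not vanish, as the integral of a nonnegative function that is positive
  -- wherever `w 0` is.
  have hZ : ∀ t, (∫ z in Ω, expWeight (w 0) t z) ≠ 0 := by
    intro t h0
    have hnn : 0 ≤ᵐ[volume.restrict Ω] expWeight (w 0) t := by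
      filter_upwards [ae_restrict_mem hΩ.measurableSet] with z hz
      exact mul_nonneg (Real.exp_nonneg _) (hw.nonneg 0 le_rfl z hz)
    rw [integral_eq_zero_iff_of_nonneg_ae hnn
      (integrableOn_expWeight hΩ (hw.integrable 0 le_rfl) t)] at h0
    have h1 : ∫ z in Ω, w 0 z = 0 := by
      rw [integral_congr_ae (g := fun _ => (0 : ℝ)), integral_zero]
      filter_upwards [h0] with z hz
      simpa [expWeight] using hz
    rw [hw.normalized 0 le_rfl] at h1
    exact one_ne_zero h1
  -- The exceptional null set is made independent of `t` through rational times.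
  have hrat : ∀ᵐ z ∂(volume.restrict Ω), ∀ r : ℚ, 0 ≤ (r : ℝ) →
      c r * w r z - expWeight (w 0) r z = 0 := by
    rw [ae_all_iff]
    intro r
    by_cases hr : 0 ≤ (r : ℝ)
    · exact (hpt r hr).mono fun z hz _ => hz
    · exact Filter.Eventually.of_forall fun z h => absurd h hr
  have hZc : Continuous fun t => ∫ v in Ω, expWeight (w 0) t v := by
    have := fun t => (hasDerivAt_integral_expWeight hΩ (hw.integrable 0 le_rfl)
      (continuousOn_const (c := (1 : ℝ))) t).continuousAt
    simp only [smul_eq_mul, mul_one] at this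
    exact continuous_iff_continuousAt.2 this
  filter_upwards [hrat, ae_restrict_mem hΩ.measurableSet] with z hz hzΩ t ht
  have hF : Continuous fun s : ℝ => w (max s 0) z :=
    (hw.continuous_time z hzΩ).comp_continuous (by fun_prop) fun s => le_max_right s 0
  have hG : Continuous fun s : ℝ =>
      expWeight (w 0) (max s 0) z / ∫ v in Ω, expWeight (w 0) (max s 0) v := by
    refine Continuous.div ?_ (hZc.comp (by fun_prop)) fun s => hZ _
    unfold expWeight
    fun_prop
  have hEq : (fun s : ℝ => w (max s 0) z) = fun s : ℝ =>
      expWeight (w 0) (max s 0) z / ∫ v in Ω, expWeight (w 0) (max s 0) v := by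
    refine Rat.isDenseEmbedding_coe_real.dense.equalizer hF hG (funext fun r => ?_)
    have hcast : max (r : ℝ) 0 = ((max r 0 : ℚ) : ℝ) := by push_cast; rfl
    have hr : 0 ≤ ((max r 0 : ℚ) : ℝ) := by rw [← hcast]; exact le_max_right _ _
    have h1 := hz (max r 0) hr
    simp only [Function.comp_apply, hcast]
    rw [eq_div_iff (hZ _), ← hcZ _ hr]
    linarith
  have := congrFun hEq t
  simpa only [max_eq_left ht] using this

end Determinacy

/-! ### The equivalences -/

section Equivalences

variable {Ω : Set (Fin 2 → ℝ)} {w : ℝ → (Fin 2 → ℝ) → ℝ} {P : ℝ → PolySeq}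
  {Λ : ℝ → Poly₂ →ₗ[ℝ] ℝ} {D : ℝ → ℝ}

lemma momentFlow_iff_weightFlow (hΛ : ∀ t, 0 ≤ t → IsIntegral Ω (w t) (Λ t))
    (hD : ∀ t, 0 ≤ t → D t = Λ t (X 0 + X 1))
    (p : Poly₂) : MomentFlow Λ p ↔ WeightFlow Ω w D (fun z => eval z p) := by
  have e : ∀ t, 0 ≤ t → ∀ q, ∫ z in Ω, w t z • eval z q = Λ t q := by
    intro t ht q
    rw [(hΛ t ht).apply_eq]
    simp only [smul_eq_mul, mul_comm]
  have hrate : ∀ t, 0 ≤ t → ∫ z in Ω, ((D t - (z 0 + z 1)) * w t z) • eval z p =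
      -Λ t ((X 0 + X 1) * p) + Λ t p * Λ t (X 0 + X 1) := by
    intro t ht
    have h1 := e t ht (C (D t) * p - (X 0 + X 1) * p)
    rw [map_sub, C_mul', map_smul, smul_eq_mul, hD t ht] at h1
    rw [hD t ht, mul_comm (Λ t p), neg_add_eq_sub, ← h1]
    congr 1
    ext z
    simp only [smul_eq_mul, map_sub, map_mul, map_add, eval_X, smul_eval]
    ring
  refine forall_congr' fun t => forall_congr' fun ht => ?_
  rw [hrate t ht]
  constructor
  · exact fun h => h.congr (fun s hs => e s hs p) (e t ht p)
  · exact fun h => h.congr (fun s hs => (e s hs p).symm) (e t ht p).symm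

lemma moment_deriv_iff (hΛ : ∀ t, 0 ≤ t → IsIntegral Ω (w t) (Λ t)) (h k : ℕ) :
    (∀ t, 0 ≤ t → HasDerivWithinAt (fun s => moment Ω (w s) h k)
          (-moment Ω (w t) (h + 1) k - moment Ω (w t) h (k + 1)
            + moment Ω (w t) h k * (moment Ω (w t) 1 0 + moment Ω (w t) 0 1)) (Ici 0) t) ↔
      MomentFlow Λ (X 0 ^ h * X 1 ^ k) := by
  refine forall_congr' fun t => forall_congr' fun ht => ?_
  have hL := hΛ t ht
  have hrate : -moment Ω (w t) (h + 1) k - moment Ω (w t) h (k + 1)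
      + moment Ω (w t) h k * (moment Ω (w t) 1 0 + moment Ω (w t) 0 1) =
      -Λ t ((X 0 + X 1) * (X 0 ^ h * X 1 ^ k)) +
        Λ t (X 0 ^ h * X 1 ^ k) * Λ t (X 0 + X 1) := by
    have h1 : ((X 0 + X 1) * (X 0 ^ h * X 1 ^ k) : Poly₂) =
        X 0 ^ (h + 1) * X 1 ^ k + X 0 ^ h * X 1 ^ (k + 1) := by ring
    rw [h1]
    simp only [hL.moment, map_add, pow_zero, pow_one, one_mul, mul_one]
    ring
  rw [hrate]
  constructor
  · exact fun h' => h'.congr (fun s hs => ((hΛ s hs).moment h k).symm) (hL.moment h k).symm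
  · exact fun h' => h'.congr (fun s hs => (hΛ s hs).moment h k) (hL.moment h k)

lemma MomentFlow.of_X_pow (h : ∀ m n, MomentFlow Λ (X 0 ^ m * X 1 ^ n)) (p : Poly₂) :
    MomentFlow Λ p :=
  MomentFlow.of_monomial (fun e _ => by rw [monomial_eq_X_pow]; exact h _ _)
    (mem_degLT_totalDegree p)

end Equivalences

end

end Toda2D

theorem theorem3p1 (Ω : Set (Fin 2 → ℝ)) (hΩ : IsCompact Ω)
    (w : ℝ → (Fin 2 → ℝ) → ℝ) (hw : IsTimeWeight Ω w)
    (P : ℝ → PolySeq) (hP : ∀ t, 0 ≤ t → IsMonicOPS Ω (w t) (P t)) :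
    List.TFAE [
      -- (i) the 2D Toda lattice, for the indices `n + 1 ≥ 1`
      (∀ t, 0 ≤ t → ∀ (i : Fin 2) (n : ℕ),
        HasEntryDeriv (fun s => coefD Ω (w s) (P s) i (n + 1))
          (sumC Ω (w t) (P t) n * shiftL i n - shiftL i (n + 1) * sumC Ω (w t) (P t) (n + 1)) t ∧
        HasEntryDeriv (fun s => coefC Ω (w s) (P s) i n)
          (sumC Ω (w t) (P t) n * coefD Ω (w t) (P t) i n
            - coefD Ω (w t) (P t) i (n + 1) * sumC Ω (w t) (P t) n) t),
      -- (ii) the Lax-Nakamura pairs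
      (∀ t, 0 ≤ t → ∀ i : Fin 2,
        HasEntryDeriv (fun s => jacobi Ω (w s) (P s) i)
          (infComm (matA Ω (w t) (P t)) (jacobi Ω (w t) (P t) i)) t),
      -- (iii) the Lax equation for the products of powers
      (∀ t, 0 ≤ t → ∀ h k : ℕ,
        HasEntryDeriv
          (fun s => infMul (infPow (jacobi Ω (w s) (P s) 0) h) (infPow (jacobi Ω (w s) (P s) 1) k))
          (infComm (matA Ω (w t) (P t))
            (infMul (infPow (jacobi Ω (w t) (P t) 0) h) (infPow (jacobi Ω (w t) (P t) 1) k))) t),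
      -- (iv) the moments
      (∀ t, 0 ≤ t → ∀ h k : ℕ,
        HasDerivWithinAt (fun s => moment Ω (w s) h k)
          (-moment Ω (w t) (h + 1) k - moment Ω (w t) h (k + 1)
            + moment Ω (w t) h k * (moment Ω (w t) 1 0 + moment Ω (w t) 0 1)) (Ici 0) t),
      -- (v) the Stieltjes function
      (∀ t, 0 ≤ t → ∀ z₁ z₂ : ℂ, (∀ z ∈ Ω, |z 0| < ‖z₁‖ ∧ |z 1| < ‖z₂‖) →
        HasDerivWithinAt (fun s => stieltjes Ω (w s) z₁ z₂)
          (((sumD Ω (w t) (P t) 0 0 0 : ℝ) - z₁ - z₂) * stieltjes Ω (w t) z₁ z₂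
            + marginal₁ Ω (w t) 0 z₁ + marginal₂ Ω (w t) 0 z₂) (Ici 0) t),
      -- (vi) the differential equation of the weight
      (∀ᵐ z ∂(volume.restrict Ω), ∀ t, 0 ≤ t →
        HasDerivWithinAt (fun s => w s z)
          (-(z 0 + z 1 - sumD Ω (w t) (P t) 0 0 0) * w t z) (Ici 0) t),
      -- (vii) the explicit form of the weight
      (∀ᵐ z ∂(volume.restrict Ω), ∀ t, 0 ≤ t →
        w t z = Real.exp (-(z 0 + z 1) * t) * w 0 z
          / ∫ v in Ω, Real.exp (-(v 0 + v 1) * t) * w 0 v),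
      -- (viii) the evolution of the monic orthogonal polynomials `ℙ_(n+1)`, coefficient-wise
      (∀ t, 0 ≤ t → ∀ (n : ℕ) (m : Fin (n + 2)) (e : Fin 2 →₀ ℕ),
        HasDerivWithinAt (fun s => (P s (n + 1) m).coeff e)
          ((∑ j, MvPolynomial.C (sumC Ω (w t) (P t) n m j) * P t n j).coeff e) (Ici 0) t)
    ] := by
  obtain ⟨Λ, hΛ⟩ := hw.exists_functional hΩ
  set D : ℝ → ℝ := fun t => sumD Ω (w t) (P t) 0 0 0 with hDdef
  have hDΛ : ∀ t, 0 ≤ t → D t = Λ t (X 0 + X 1) := fun t ht => sumD_zero (hP t ht) (hΛ t ht) 0 0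
  have hDint : ∀ t, 0 ≤ t → D t = ∫ z in Ω, (z 0 + z 1) * w t z := fun t ht => by
    rw [hDΛ t ht, (hΛ t ht).apply_eq]
    simp
  obtain ⟨R, hR0, hR⟩ := exists_abs_coord_le hΩ
  have hDR : ∀ t, 0 ≤ t → |D t| ≤ 2 * R := fun t ht => by
    have h := hw.norm_integral_le hΩ ht (f := fun z => z 0 + z 1) (C := 2 * R)
      fun z hz => abs_exponent_le (hR z hz)
    rw [hDint t ht]
    simpa only [smul_eq_mul, mul_comm, Real.norm_eq_abs] using h
  have hK : ∀ t, 0 ≤ t → ∀ z ∈ Ω, |D t - (z 0 + z 1)| ≤ 4 * R := fun t ht z hz =>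
    (abs_sub _ _).trans (by linarith [hDR t ht, abs_exponent_le (hR z hz)])
  tfae_have 1 → 2 := laxFlow_of_lattice hP hΛ
  tfae_have 2 → 1 := fun h t ht i n => LaxFlow.lattice h ht i n
  tfae_have 2 → 3 := fun h t ht m n => LaxFlow.jacobiMonomial h ht m n
  tfae_have 3 → 4 := by
    intro h t ht m n
    rw [← infComm_jacobiMonomial_zero_zero (hP t ht) (hΛ t ht) m n]
    exact (h t ht m n ⟨0, 0⟩ ⟨0, 0⟩).congr
      (fun s hs => (jacobiMonomial_zero_zero (hP s hs) (hΛ s hs) m n).symm)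
      (jacobiMonomial_zero_zero (hP t ht) (hΛ t ht) m n).symm
  have h4 : (∀ t, 0 ≤ t → ∀ h k : ℕ, HasDerivWithinAt (fun s => moment Ω (w s) h k)
      (-moment Ω (w t) (h + 1) k - moment Ω (w t) h (k + 1)
        + moment Ω (w t) h k * (moment Ω (w t) 1 0 + moment Ω (w t) 0 1)) (Ici 0) t) ↔
      ∀ p, MomentFlow Λ p := by
    constructor
    · exact fun h => MomentFlow.of_X_pow fun m n =>
        (moment_deriv_iff hΛ m n).1 fun t ht => h t ht m n
    · exact fun h t ht m n => (moment_deriv_iff hΛ m n).2 (h _) t ht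
  tfae_have 4 → 8 := fun h => (polyFlow_iff hP).1 (polyFlow_of_momentFlow hP hΛ (h4.1 h))
  tfae_have 8 → 2 := fun h => laxFlow_of_polyFlow hP hΛ ((polyFlow_iff hP).2 h)
  tfae_have 4 → 7 := by
    intro h
    have hm := h4.1 h
    refine explicitWeight_of_weightFlow (D := D) hΩ hw (fun t ht => ?_) fun p =>
      (momentFlow_iff_weightFlow hΛ hDΛ p).1 (hm p)
    exact (hm (X 0 + X 1) t ht).continuousWithinAt.congr (fun s hs => hDΛ s hs) (hDΛ t ht)
  tfae_have 7 → 5 := fun h => (stieltjes_flow_iff (D := D) hΩ hw).2 fun z₁ z₂ hz =>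
    ExplicitWeight.weightFlow hΩ hw hDint h
      ((continuousOn_inv_sub fun z hzΩ => (hz z hzΩ).1).mul
        (continuousOn_inv_sub fun z hzΩ => (hz z hzΩ).2))
  tfae_have 5 → 4 := by
    intro h
    have hk := (stieltjes_flow_iff (D := D) hΩ hw).1 h
    refine h4.2 (MomentFlow.of_X_pow fun m n => ?_)
    rw [momentFlow_iff_weightFlow hΛ hDΛ]
    simpa using WeightFlow.monomial_of_stieltjesKernel hΩ hw hK hk m n
  tfae_have 7 → 6 := fun h => ExplicitWeight.weightODE hΩ hw hDint h
  tfae_have 6 → 7 := fun h => WeightODE.explicitWeight hw hDR h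
  tfae_finish
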